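/- Let $\xi$ be a random variable with law $P$, let $f(\cdot;\xi):\mathbb{R}^d\to\mathbb{R}$, and let $F(w)=\mathbb{E}[f(w;\xi)]$ (finite for every $w$). Suppose that * $F$ is $\mu$-strongly convex, $\mu>0$: $F(w)-F(w')\ge\langle\nabla F(w'),w-w'\rangle+\frac{\mu}{2}\|w-w'\|^2$ for all $w,w'$; * each $f(\cdot;\xi)$ is $L$-smooth, $L>0$: $\|\nabla f(w;\xi)-\nabla f(w';\xi)\|\le L\|w-w'\|$ for all $w,w'$ (the functions $f(\cdot;\xi)$ need not be convex). Let $w_*$ be the minimizer of $F$, let $N=2\,\mathbb{E}[\|\nabla f(w_*;\xi)\|^2]<\infty$, and let $\kappa=L/\mu$. Let $D_\xi\subseteq\{1,\dots,d\}$ be the set of the positions $i$ such that $[\nabla f(w;\xi)]_i\ne0$ for some $w$. Fix an integer $D\ge1$ and, for each $\xi$, a partition of $D_\xi$ into $d_\xi=\min\{D,|D_\xi|\}$ non-empty sets $S^\xi_u$, each of size $\lfloor|D_\xi|/D\rfloor$ or $\lceil|D_\xi|/D\rceil$; identify each set with the corresponding diagonal 0/1-matrix. Fix an integer $\tau\ge0$,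 and write $t-\tau$ for $\max\{t-\tau,0\}$. Starting from $w_0\in\mathbb{R}^d$, the Hogwild! general recursion is, for $t\ge0$, $$w_{t+1}=w_t-\eta_t d_{\xi_t}S^{\xi_t}_{u_t}\nabla f(\hat w_t;\xi_t),\qquad \hat w_t=w_{t-\tau}-\sum_{j=t-\tau}^{t-1}\eta_j d_{\xi_j}\Sigma_{t,j}S^{\xi_j}_{u_j}\nabla f(\hat w_j;\xi_j),$$ where the $\Sigma_{t,j}$ are arbitrary, possibly random, diagonal 0/1-matrices (inconsistent reads with delay $\tau$), and where $\xi_t$ has law $P$, $u_t$ is uniform on the $d_{\xi_t}$ indices given $\xi_t$ (nothing is updated if $D_{\xi_t}=\emptyset$), and $(\xi_t,u_t)$ is independent of all $(\xi_j,u_j)$, $j<t$, and all $\Sigma_{s,j}$, $s\le t$. Let $\eta_t=\frac{\alpha_t}{\mu(t+E)}$ with $4\le\alpha_t\le\alpha$ and $E\ge\frac{4L\kappa\alpha D}{\mu}$ (for example $E=\max\{2\tau,\frac{4L\kappa\alpha D}{\mu}\}$). Let $\bar\Delta_D=D\cdot\mathbb{E}[\lceil|D_\xi|/D\rceil]$.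 Then the expected number of single vector entry updates in the first $t$ iterations is at most $t'=t\bar\Delta_D/D$, with equality if almost surely $|D_\xi|\le D$ or $D$ divides $|D_\xi|$. Moreover, $\mathbb{E}[\|\hat w_t-w_*\|^2]$ and $\mathbb{E}[\|w_t-w_*\|^2]$ are finite for every $t$, and both are at most $$\frac{4\alpha^2DN}{\mu^2}\,\frac{t}{(t+E-1)^2}+O\!\left(\frac{\ln t}{(t+E-1)^2}\right),$$ where the bound on the $O$-term holds for all $t\ge2$ with a constant that depends only on $\mu,L,\alpha,E,D,\tau,N$ and $\|w_0-w_*\|$. -/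

import Mathlib

open MeasureTheory ProbabilityTheory

open scoped ENNReal

noncomputable section

namespace Hogwild

/-- The parameter space `ℝ^d` with its Euclidean norm. -/
abbrev Vec (d : ℕ) := EuclideanSpace ℝ (Fin d)

/-! ### The objective and the assumptions on it -/

/-- The objective `F(w) = 𝔼[f(w; ξ)]`, where `ξ` has law `P` and `f x w` stands for `f(w; x)`. -/
def risk {d : ℕ} {Ξ : Type*} [MeasurableSpace Ξ] (P : Measure Ξ) (f : Ξ → Vec d → ℝ)
    (w : Vec d) : ℝ :=
  ∫ x, f x w ∂P

/-- `F` is `μ`-strongly convex, for a differentiable `F`. -/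
def IsStronglyConvex {d : ℕ} (μ : ℝ) (F : Vec d → ℝ) : Prop :=
  Differentiable ℝ F ∧
    ∀ w w' : Vec d, F w - F w' ≥ inner ℝ (gradient F w') (w - w') + μ / 2 * ‖w - w'‖ ^ 2

/-- `g` is `L`-smooth: differentiable with an `L`-Lipschitz gradient. -/
def IsSmooth {d : ℕ} (L : ℝ) (g : Vec d → ℝ) : Prop :=
  Differentiable ℝ g ∧ ∀ w w' : Vec d, ‖gradient g w - gradient g w'‖ ≤ L * ‖w - w'‖

/-! ### The supports `D_ξ` and the filters `S^ξ_u` -/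

open Classical in
/-- The set `D_ξ` of the positions at which some gradient `∇f(w; ξ)` is non-zero, for
`g = f(·; ξ)`. -/
def gradSupport {d : ℕ} (g : Vec d → ℝ) : Finset (Fin d) :=
  Finset.univ.filter fun i => ∃ w : Vec d, gradient g w i ≠ 0

/-- The number `d_ξ` of filters belonging to `ξ`, for `g = f(·; ξ)`: there are `D` of them if
`D ≤ |D_ξ|`, and `|D_ξ|` (singletons) otherwise. -/
def numFilters {d : ℕ} (D : ℕ) (g : Vec d → ℝ) : ℕ :=
  min D (gradSupport g).card

/-- `S x 0, …, S x (d_x - 1)` are non-empty sets that partition `D_x`, each of size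
`⌊|D_x| / D⌋` or `⌈|D_x| / D⌉`. There are no further filters: `S x u` is empty for `u ≥ d_x`. -/
structure IsFilterFamily {d : ℕ} {Ξ : Type*} [MeasurableSpace Ξ] (D : ℕ) (f : Ξ → Vec d → ℝ)
    (S : Ξ → ℕ → Finset (Fin d)) : Prop where
  measurable : ∀ (u : ℕ) (i : Fin d), MeasurableSet {x | i ∈ S x u}
  nonempty : ∀ (x : Ξ) (u : ℕ), u < numFilters D (f x) → (S x u).Nonempty
  disjoint : ∀ (x : Ξ) (u v : ℕ), u < numFilters D (f x) → v < numFilters D (f x) → u ≠ v →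
    Disjoint (S x u) (S x v)
  union : ∀ x : Ξ, (Finset.range (numFilters D (f x))).biUnion (S x) = gradSupport (f x)
  size : ∀ (x : Ξ) (u : ℕ), u < numFilters D (f x) →
    (S x u).card = ⌊((gradSupport (f x)).card : ℝ) / D⌋₊ ∨
      (S x u).card = ⌈((gradSupport (f x)).card : ℝ) / D⌉₊
  outside : ∀ (x : Ξ) (u : ℕ), numFilters D (f x) ≤ u → S x u = ∅

/-- The probability of drawing the filter with index `u` given `ξ`, for `g = f(·; ξ)`: uniform
on `{0, …, d_ξ - 1}`. (If `D_ξ` is empty, then there is no filter to draw, nothing will be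
updated, and the index is `0` by convention.) -/
def filterProb {d : ℕ} (D : ℕ) (g : Vec d → ℝ) (u : ℕ) : ℝ≥0∞ :=
  if u < max 1 (numFilters D g) then ((max 1 (numFilters D g) : ℕ) : ℝ≥0∞)⁻¹ else 0

/-- The parameter `Δ̄_D = D · 𝔼[⌈|D_ξ| / D⌉]`. -/
def deltaBar {d : ℕ} {Ξ : Type*} [MeasurableSpace Ξ] (P : Measure Ξ) (f : Ξ → Vec d → ℝ)
    (D : ℕ) : ℝ :=
  D * ∫ x, (⌈((gradSupport (f x)).card : ℝ) / D⌉₊ : ℝ) ∂P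

/-! ### The general recursion with inconsistent reads -/

/-- The vector that agrees with `v` at the positions in `s` and is zero elsewhere, that is, the
product of `v` with the diagonal 0/1-matrix given by `s`. -/
def restrict {d : ℕ} (s : Finset (Fin d)) (v : Vec d) : Vec d :=
  WithLp.toLp 2 fun i => if i ∈ s then v i else 0

/-- The update direction `d_x S^x_u ∇f(v; x)`. -/
def direction {d : ℕ} {Ξ : Type*} (D : ℕ) (f : Ξ → Vec d → ℝ) (S : Ξ → ℕ → Finset (Fin d))
    (x : Ξ) (u : ℕ) (v : Vec d) : Vec d :=
  (numFilters D (f x) : ℝ) • restrict (S x u) (gradient (f x) v)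

/-- The σ-algebra `ℱ_t` of everything that happened before the sample of iteration `t` is drawn:
it is generated by the samples `(ξ_j, u_j)` with `j < t` and by the masks of the reads
`ŵ_0, …, ŵ_t`. -/
abbrev past {d : ℕ} {Ξ Ω : Type*} [MeasurableSpace Ξ] (τ : ℕ) (ξ : ℕ → Ω → Ξ) (u : ℕ → Ω → ℕ)
    (mask : ℕ → ℕ → Ω → Fin d → Bool) (t : ℕ) : MeasurableSpace Ω :=
  (⨆ j ∈ Finset.range t, MeasurableSpace.comap (fun ω => (ξ j ω, u j ω)) inferInstance) ⊔
    ⨆ s ∈ Finset.range (t + 1), ⨆ j ∈ Finset.Ico (s - τ) s,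
      MeasurableSpace.comap (mask s j) inferInstance

/-- A run, on the probability space `(Ω, ρ)`, of the general recursion
`w_{t+1} = w_t - η_t d_{ξ_t} S^{ξ_t}_{u_t} ∇f(ŵ_t; ξ_t)` started at `w₀`, with shared memory that
is consistent with delay `τ`: the vector `ŵ_t` that is read consists of `w_{t-τ}` and of an
arbitrary selection, position by position, of the updates made after `w_{t-τ}`. Here `t - τ` means
`max (t - τ) 0`, and `mask t j ω i = true` says that the update of position `i` made in the step
from `w_j` to `w_{j+1}` is included in `ŵ_t`. The selection may be random and may depend on the
past; the sample `(ξ_t, u_t)` is drawn after the read of `ŵ_t`, independently of `ℱ_t`. -/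
structure IsRun {d : ℕ} {Ξ Ω : Type*} [MeasurableSpace Ξ] [MeasurableSpace Ω]
    (P : Measure Ξ) (f : Ξ → Vec d → ℝ) (D : ℕ) (S : Ξ → ℕ → Finset (Fin d)) (τ : ℕ)
    (η : ℕ → ℝ) (w₀ : Vec d) (ρ : Measure Ω) (ξ : ℕ → Ω → Ξ) (u : ℕ → Ω → ℕ)
    (mask : ℕ → ℕ → Ω → Fin d → Bool) (w what : ℕ → Ω → Vec d) : Prop where
  measurable_sample : ∀ t, Measurable (ξ t)
  measurable_index : ∀ t, Measurable (u t)
  measurable_mask : ∀ t j, Measurable (mask t j)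
  /-- `ξ_t` has law `P`, and `u_t` is uniformly distributed given `ξ_t`. -/
  law : ∀ (t : ℕ) (A : Set Ξ), MeasurableSet A → ∀ k : ℕ,
    ρ {ω | ξ t ω ∈ A ∧ u t ω = k} = ∫⁻ x in A, filterProb D (f x) k ∂P
  indep : ∀ t, Indep (past τ ξ u mask t)
    (MeasurableSpace.comap (fun ω => (ξ t ω, u t ω)) inferInstance) ρ
  start : ∀ ω, w 0 ω = w₀
  read : ∀ t ω, what t ω = w (t - τ) ω - ∑ j ∈ Finset.Ico (t - τ) t,
    η j • restrict (Finset.univ.filter fun i => mask t j ω i = true)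
      (direction D f S (ξ j ω) (u j ω) (what j ω))
  step : ∀ t ω, w (t + 1) ω = w t ω - η t • direction D f S (ξ t ω) (u t ω) (what t ω)

/-- The number of single vector entry updates made in the first `t` iterations. -/
def numUpdates {d : ℕ} {Ξ Ω : Type*} (S : Ξ → ℕ → Finset (Fin d)) (ξ : ℕ → Ω → Ξ)
    (u : ℕ → Ω → ℕ) (t : ℕ) (ω : Ω) : ℕ :=
  ∑ j ∈ Finset.range t, (S (ξ j ω) (u j ω)).card

end Hogwild

end

/-! Write `e t`, `e' t` and `δ t` for the mean square distances from the iterate to the minimizer,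
from the read vector to the minimizer, and from the read vector to the iterate. The proof reduces
the stochastic process to a deterministic recursion for these three sequences.

The pair of iterate and read is measurable with respect to the past (`IsRun.measurable_past`), hence
independent of the fresh sample. Averaging over the filter index cancels the factor `d_ξ`: the
update direction is an unbiased estimate of `∇F` at the read vector (`IsRun.integral_inner_step`),
and its second moment is at most `D (2 L² e' t + N)` (`IsRun.integral_norm_step_sq_le`). Expand the
square of the next error. Strong convexity of `F`, with Young's inequality for the mismatch between
iterate and read, yields a decrease in both `e t` and `e' t` at the price of a multiple of `δ t`.
The lower bound on `E` makes the steps small enough for the decrease in `e' t` to absorb the `L²`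
part of the second moment, so convexity of the components is never needed
(`IsRun.integral_norm_succ_sq_le`).

A read misses only parts of the last `τ` updates, so `δ t` is controlled by squared steps times
second moments of these updates (`IsRun.integral_norm_read_sub_sq_le`). Since the squared step sizes
are summable, a discrete Grönwall argument bounds all `e' t` (`IsDelayedRecursion.exists_bound`),
and therefore `δ t = O(1/(t+E)²)`. The contraction factor is at most `1 - 2/(t+E)`, and `(t+E)² -
2(t+E) = (t+E-1)² - 1`, so `(t+E-1)² e t` grows per step by at most `A = (α/μ)² D N` plus
`O(1/(t+E))`. Summation gives `A t + O(ln t)`; passing to reads costs a factor two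
(`IsDelayedRecursion.exists_rate`).

The update count is separate: given `ξ`, a random filter has mean size `|D_ξ|/d_ξ`, which is
compared with `⌈|D_ξ|/D⌉`. -/

namespace Hogwild

open Filter Topology

/-! ### Gradients of smooth functions: measurability and growth. -/

section Gradient

variable {d : ℕ} {Ξ : Type*} [MeasurableSpace Ξ] {L : ℝ} {f : Ξ → Vec d → ℝ}

lemma IsSmooth.continuous_gradient {g : Vec d → ℝ} (h : IsSmooth L g) : Continuous (gradient g) := by
  have : LipschitzWith L.toNNReal (gradient g) := by
    refine LipschitzWith.of_dist_le_mul fun v w => ?_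
    rw [dist_eq_norm, dist_eq_norm]
    refine (h.2 v w).trans ?_
    gcongr
    exact Real.le_coe_toNNReal L
  exact this.continuous

lemma inner_gradient {g : Vec d → ℝ} (v z : Vec d) : inner ℝ (gradient g v) z = fderiv ℝ g v z := by
  simp [gradient]

lemma gradient_apply {g : Vec d → ℝ} (v : Vec d) (i : Fin d) :
    gradient g v i = fderiv ℝ g v (EuclideanSpace.single i 1) := by
  rw [← inner_gradient, EuclideanSpace.inner_single_right]
  simp

lemma measurable_vec {X : Type*} [MeasurableSpace X] {g : X → Vec d}
    (h : ∀ i, Measurable fun x => g x i) : Measurable g :=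
  (WithLp.measurable_toLp 2 (Fin d → ℝ)).comp (measurable_pi_iff.2 h)

lemma measurable_vec_apply {X : Type*} [MeasurableSpace X] {g : X → Vec d}
    (h : Measurable g) (i : Fin d) : Measurable fun x => g x i :=
  (measurable_pi_apply i).comp ((WithLp.measurable_ofLp 2 (Fin d → ℝ)).comp h)

/-- Partial derivatives are pointwise limits of difference quotients, which are measurable in the
sample. -/
lemma measurable_gradient (hf : ∀ v, Measurable fun x => f x v)
    (hd : ∀ x, Differentiable ℝ (f x)) (v : Vec d) : Measurable fun x => gradient (f x) v := by
  refine measurable_vec fun i => ?_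
  simp_rw [gradient_apply]
  refine measurable_of_tendsto_metrizable (f := fun (n : ℕ) x =>
    (n : ℝ) • (f x (v + (n : ℝ)⁻¹ • EuclideanSpace.single i (1 : ℝ)) - f x v)) (fun n => ?_) ?_
  · simp only [smul_eq_mul]
    exact ((hf _).sub (hf _)).const_mul _
  · refine tendsto_pi_nhds.2 fun x => ?_
    refine (hd x v).hasFDerivAt.lim _ ?_
    simpa using tendsto_natCast_atTop_atTop (R := ℝ)

/-- Carathéodory: continuity in the point and measurability in the sample give joint measurability.
-/
lemma measurable_gradient_uncurry (hf : ∀ v, Measurable fun x => f x v)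
    (hs : ∀ x, IsSmooth L (f x)) : Measurable fun p : Ξ × Vec d => gradient (f p.1) p.2 :=
  (measurable_uncurry_of_continuous_of_measurable (u := fun v x => gradient (f x) v)
    (fun x => (hs x).continuous_gradient)
    (measurable_gradient hf fun x => (hs x).1)).comp measurable_swap

lemma IsSmooth.norm_gradient_le {g : Vec d → ℝ} (h : IsSmooth L g) (v w : Vec d) :
    ‖gradient g v‖ ≤ ‖gradient g w‖ + L * ‖v - w‖ := by
  have := norm_le_norm_add_norm_sub (gradient g w) (gradient g v)
  rw [← norm_sub_rev] at this
  exact this.trans (by gcongr; simpa [norm_sub_rev] using h.2 v w)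

lemma IsSmooth.norm_gradient_sq_le {g : Vec d → ℝ} (h : IsSmooth L g)
    (v w : Vec d) :
    ‖gradient g v‖ ^ 2 ≤ 2 * L ^ 2 * ‖v - w‖ ^ 2 + 2 * ‖gradient g w‖ ^ 2 := by
  have h1 := h.norm_gradient_le v w
  have h2 : ‖gradient g v‖ ^ 2 ≤ (‖gradient g w‖ + L * ‖v - w‖) ^ 2 := by gcongr
  nlinarith [sq_nonneg (‖gradient g w‖ - L * ‖v - w‖)]

end Gradient

/-! ### Filters: measurability and averages over the random index. -/

section Filters

variable {d : ℕ} {Ξ : Type*} [MeasurableSpace Ξ] {D : ℕ} {L : ℝ} {f : Ξ → Vec d → ℝ}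
  {S : Ξ → ℕ → Finset (Fin d)}

lemma numFilters_le (g : Vec d → ℝ) : numFilters D g ≤ D := min_le_left _ _

@[simp] lemma restrict_apply (s : Finset (Fin d)) (v : Vec d) (i : Fin d) :
    restrict s v i = if i ∈ s then v i else 0 := rfl

lemma norm_restrict_sq (s : Finset (Fin d)) (v : Vec d) :
    ‖restrict s v‖ ^ 2 = ∑ i ∈ s, v i ^ 2 := by
  rw [EuclideanSpace.real_norm_sq_eq]
  simp [ite_pow, Finset.sum_ite_mem]

lemma norm_restrict_le (s : Finset (Fin d)) (v : Vec d) : ‖restrict s v‖ ≤ ‖v‖ := by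
  refine le_of_sq_le_sq ?_ (norm_nonneg _)
  rw [norm_restrict_sq, EuclideanSpace.real_norm_sq_eq]
  exact Finset.sum_le_univ_sum_of_nonneg fun i => sq_nonneg _

lemma norm_direction_le {Ξ : Type*} {f : Ξ → Vec d → ℝ} {S : Ξ → ℕ → Finset (Fin d)}
    (x : Ξ) (u : ℕ) (v : Vec d) :
    ‖direction D f S x u v‖ ≤ D * ‖gradient (f x) v‖ := by
  rw [direction, norm_smul, Real.norm_natCast]
  gcongr
  · exact numFilters_le _
  · exact norm_restrict_le _ _

lemma mem_gradSupport {g : Vec d → ℝ} {v : Vec d} {i : Fin d} (h : gradient g v i ≠ 0) :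
    i ∈ gradSupport g := by
  simp only [gradSupport, Finset.mem_filter, Finset.mem_univ, true_and]
  exact ⟨v, h⟩

namespace IsFilterFamily

lemma mem_gradSupport_iff (hS : IsFilterFamily D f S) (x : Ξ) (i : Fin d) :
    i ∈ gradSupport (f x) ↔ ∃ k, i ∈ S x k := by
  rw [← hS.union x]
  simp only [Finset.mem_biUnion, Finset.mem_range]
  refine ⟨fun ⟨k, _, h⟩ => ⟨k, h⟩, fun ⟨k, h⟩ => ⟨k, ?_, h⟩⟩
  by_contra hk
  rw [hS.outside x k (not_lt.1 hk)] at h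
  simp at h

lemma sum_filters (hS : IsFilterFamily D f S) (x : Ξ) {M : Type*} [AddCommMonoid M]
    (h : Fin d → M) :
    ∑ k ∈ Finset.range (numFilters D (f x)), ∑ i ∈ S x k, h i = ∑ i ∈ gradSupport (f x), h i := by
  rw [← hS.union x, Finset.sum_biUnion]
  intro k hk l hl hkl
  exact hS.disjoint x k l (by simpa using hk) (by simpa using hl) hkl

/-- The support is defined by an uncountable union over points; as the union of the filters it
becomes a countable union of measurable conditions. -/
lemma measurable_card_gradSupport (hS : IsFilterFamily D f S) :
    Measurable fun x => (gradSupport (f x)).card := by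
  classical
  have : (fun x => (gradSupport (f x)).card) =
      fun x => ∑ i : Fin d, Set.indicator {x | ∃ k, i ∈ S x k} (fun _ => 1) x := by
    funext x
    simp only [Set.indicator_apply, Set.mem_ofPred_eq, ← hS.mem_gradSupport_iff]
    simp
  rw [this]
  refine Finset.measurable_sum _ fun i _ => measurable_const.indicator ?_
  simp only [Set.ofPred_exists]
  exact MeasurableSet.iUnion fun k => hS.measurable k i

lemma measurable_numFilters (hS : IsFilterFamily D f S) :
    Measurable fun x => numFilters D (f x) :=
  measurable_const.min hS.measurable_card_gradSupport

lemma measurable_filterProb (hS : IsFilterFamily D f S) (k : ℕ) :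
    Measurable fun x => filterProb D (f x) k :=
  (measurable_from_top (f := fun n : ℕ => if k < max 1 n then ((max 1 n : ℕ) : ℝ≥0∞)⁻¹ else 0)).comp
    hS.measurable_numFilters

lemma measurable_card (hS : IsFilterFamily D f S) :
    Measurable fun p : Ξ × ℕ => (S p.1 p.2).card := by
  classical
  refine measurable_from_prod_countable_left fun k => ?_
  have : (fun x => (S x k).card) =
      fun x => ∑ i : Fin d, Set.indicator {x | i ∈ S x k} (fun _ => 1) x := by
    funext x
    simp [Set.indicator_apply]
  simp only
  rw [this]
  exact Finset.measurable_sum _ fun i _ => measurable_const.indicator (hS.measurable k i)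

lemma measurable_direction (hS : IsFilterFamily D f S) (hf : ∀ v, Measurable fun x => f x v)
    (hs : ∀ x, IsSmooth L (f x)) :
    Measurable fun p : (Ξ × ℕ) × Vec d => direction D f S p.1.1 p.1.2 p.2 := by
  classical
  refine Measurable.smul (f := fun p : (Ξ × ℕ) × Vec d => (numFilters D (f p.1.1) : ℝ))
    (g := fun p => restrict (S p.1.1 p.1.2) (gradient (f p.1.1) p.2)) ?_
    (measurable_vec fun i => ?_)
  · exact (measurable_from_top (f := fun n : ℕ => (n : ℝ))).comp
      (hS.measurable_numFilters.comp (measurable_fst.comp measurable_fst))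
  · simp only [restrict_apply]
    refine Measurable.ite ?_ ?_ measurable_const
    · have h : MeasurableSet {q : Ξ × ℕ | i ∈ S q.1 q.2} := by
        have : {q : Ξ × ℕ | i ∈ S q.1 q.2} = ⋃ k : ℕ, {x | i ∈ S x k} ×ˢ {k} := by
          ext q; simp
        rw [this]
        exact MeasurableSet.iUnion fun k => (hS.measurable k i).prod (measurableSet_singleton k)
      exact measurable_fst h
    · exact measurable_vec_apply ((measurable_gradient_uncurry hf hs).comp
        ((measurable_fst.comp measurable_fst).prodMk measurable_snd)) i

end IsFilterFamily

/-- The average of `h` over the random index of a filter. -/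
lemma sum_filterProb_smul (hD : 1 ≤ D) (g : Vec d → ℝ) {M : Type*} [AddCommGroup M] [Module ℝ M]
    (h : ℕ → M) :
    ∑ k ∈ Finset.range D, (filterProb D g k).toReal • h k =
      ((max 1 (numFilters D g) : ℕ) : ℝ)⁻¹ • ∑ k ∈ Finset.range (max 1 (numFilters D g)), h k := by
  have hle : max 1 (numFilters D g) ≤ D := max_le hD (numFilters_le g)
  rw [Finset.smul_sum, ← Finset.sum_subset (Finset.range_mono hle)]
  · refine Finset.sum_congr rfl fun k hk => ?_
    rw [filterProb, if_pos (Finset.mem_range.1 hk), ENNReal.toReal_inv, ENNReal.toReal_natCast]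
  · intro k _ hk
    rw [filterProb, if_neg (by simpa using hk)]
    simp

lemma filterProb_le_one (g : Vec d → ℝ) (k : ℕ) : filterProb D g k ≤ 1 := by
  rw [filterProb]
  split_ifs
  · rw [ENNReal.inv_le_one]
    exact_mod_cast le_max_left _ _
  · simp

lemma filterProb_eq_zero (hD : 1 ≤ D) (g : Vec d → ℝ) {k : ℕ} (hk : D ≤ k) :
    filterProb D g k = 0 := by
  rw [filterProb, if_neg]
  exact not_lt.2 ((max_le hD (numFilters_le g)).trans hk)

lemma gradSupport_eq_empty (hD : 1 ≤ D) {g : Vec d → ℝ} (h : numFilters D g = 0) :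
    gradSupport g = ∅ := by
  rw [numFilters] at h
  rw [← Finset.card_eq_zero]
  omega

lemma gradient_eq_zero (hD : 1 ≤ D) {g : Vec d → ℝ} (h : numFilters D g = 0) (v : Vec d) :
    gradient g v = 0 := by
  ext i
  by_contra hi
  have := mem_gradSupport hi
  rw [gradSupport_eq_empty hD h] at this
  simp at this

/-- Unbiasedness: the factor `d_x` cancels the uniform weight `1/d_x`, and the filters partition the
support, outside which the gradient vanishes. -/
lemma sum_filterProb_smul_direction (hD : 1 ≤ D) (hS : IsFilterFamily D f S) (x : Ξ) (v : Vec d) :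
    ∑ k ∈ Finset.range D, (filterProb D (f x) k).toReal • direction D f S x k v =
      gradient (f x) v := by
  rw [sum_filterProb_smul hD]
  rcases Nat.eq_zero_or_pos (numFilters D (f x)) with h | h
  · simp [h, direction, gradient_eq_zero hD h]
  · rw [max_eq_right h]
    simp only [direction]
    rw [← Finset.smul_sum, smul_smul, inv_mul_cancel₀ (by positivity), one_smul]
    ext i
    have : ∑ k ∈ Finset.range (numFilters D (f x)),
        ∑ j ∈ S x k, (if j = i then gradient (f x) v i else 0) = gradient (f x) v i := by
      rw [hS.sum_filters]
      simp only [Finset.sum_ite_eq']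
      split_ifs with hi
      · rfl
      · by_contra h0
        exact hi (mem_gradSupport (Ne.symm h0))
    simpa using this

/-- The weight `1/d_x` meets the square of `d_x`, and the squared norms of the pieces add up to that
of the gradient. One factor `d_x ≤ D` survives; it is the `D` in the rate. -/
lemma sum_filterProb_smul_norm_direction_sq (hD : 1 ≤ D) (hS : IsFilterFamily D f S) (x : Ξ)
    (v : Vec d) :
    ∑ k ∈ Finset.range D, (filterProb D (f x) k).toReal • ‖direction D f S x k v‖ ^ 2 ≤
      D * ‖gradient (f x) v‖ ^ 2 := by
  rw [sum_filterProb_smul hD]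
  rcases Nat.eq_zero_or_pos (numFilters D (f x)) with h | h
  · simp only [h, direction, gradient_eq_zero hD h]
    simp
  · rw [max_eq_right h]
    simp only [direction, norm_smul, mul_pow, norm_restrict_sq]
    rw [← Finset.mul_sum, hS.sum_filters, smul_eq_mul, Real.norm_natCast, ← mul_assoc, sq,
      ← mul_assoc, inv_mul_cancel₀ (by positivity), one_mul, EuclideanSpace.real_norm_sq_eq]
    gcongr
    · exact numFilters_le _
    · exact Finset.subset_univ _

lemma sum_filterProb_smul_card (hD : 1 ≤ D) (hS : IsFilterFamily D f S) (x : Ξ) :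
    ∑ k ∈ Finset.range D, (filterProb D (f x) k).toReal • ((S x k).card : ℝ) =
      ((max 1 (numFilters D (f x)) : ℕ) : ℝ)⁻¹ * (gradSupport (f x)).card := by
  rw [sum_filterProb_smul hD, smul_eq_mul]
  congr 1
  rcases Nat.eq_zero_or_pos (numFilters D (f x)) with h | h
  · simp [h, hS.outside x 0, gradSupport_eq_empty hD h]
  · rw [max_eq_right h]
    have := hS.sum_filters x (fun _ => (1 : ℝ))
    simpa using this

/-- If `D ≤ |D_x|` then `d_x = D` and the ratio lies below its ceiling; otherwise a non-empty
support gives ratio `1`, and the ceiling of a positive number is at least `1`. -/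
lemma card_div_le_ceil (hD : 1 ≤ D) (g : Vec d → ℝ) :
    ((max 1 (numFilters D g) : ℕ) : ℝ)⁻¹ * (gradSupport g).card ≤
      ⌈((gradSupport g).card : ℝ) / D⌉₊ := by
  rcases Nat.eq_zero_or_pos (numFilters D g) with h | h
  · simp [gradSupport_eq_empty hD h]
  · rw [max_eq_right h, inv_mul_eq_div]
    rcases le_total D (gradSupport g).card with h' | h'
    · rw [numFilters, min_eq_left h']
      exact Nat.le_ceil _
    · have h0 : 0 < (gradSupport g).card := h.trans_le (min_le_right _ _)
      rw [numFilters, min_eq_right h', div_self (by positivity)]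
      have : 0 < ⌈((gradSupport g).card : ℝ) / D⌉₊ := Nat.ceil_pos.2 (by positivity)
      exact_mod_cast this

lemma card_div_eq_ceil (hD : 1 ≤ D) (g : Vec d → ℝ)
    (hg : (gradSupport g).card ≤ D ∨ D ∣ (gradSupport g).card) :
    ((max 1 (numFilters D g) : ℕ) : ℝ)⁻¹ * (gradSupport g).card =
      ⌈((gradSupport g).card : ℝ) / D⌉₊ := by
  have hD' : (0 : ℝ) < D := by exact_mod_cast hD
  rcases Nat.eq_zero_or_pos (numFilters D g) with h | h
  · simp [gradSupport_eq_empty hD h]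
  · rw [max_eq_right h, inv_mul_eq_div]
    have h0 : 0 < (gradSupport g).card := h.trans_le (min_le_right _ _)
    rcases hg with h' | ⟨m, hm⟩
    · rw [numFilters, min_eq_right h', div_self (by positivity)]
      have : ⌈((gradSupport g).card : ℝ) / D⌉₊ = 1 := by
        refine le_antisymm (Nat.ceil_le.2 ?_) (Nat.ceil_pos.2 (by positivity))
        rw [div_le_iff₀ hD']
        exact_mod_cast (by simpa using h')
      rw [this]; simp
    · have hm0 : D ≤ (gradSupport g).card := Nat.le_of_dvd h0 ⟨m, hm⟩
      rw [numFilters, min_eq_left hm0, hm]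
      push_cast
      rw [mul_div_cancel_left₀ _ hD'.ne', Nat.ceil_natCast]

end Filters

/-! ### The gradient of the expected loss. -/

section Risk

variable {d : ℕ} {Ξ : Type*} [MeasurableSpace Ξ] {P : Measure Ξ} [IsProbabilityMeasure P]
  {L : ℝ} {f : Ξ → Vec d → ℝ} {wstar : Vec d}

lemma integrable_gradient (hf : ∀ v, Measurable fun x => f x v) (hs : ∀ x, IsSmooth L (f x))
    (hN : Integrable (fun x => ‖gradient (f x) wstar‖ ^ 2) P) (v : Vec d) :
    Integrable (fun x => gradient (f x) v) P := by
  have hm := fun v => (measurable_gradient hf (fun x => (hs x).1) v).aestronglyMeasurable (μ := P)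
  have h : Integrable (fun x => gradient (f x) wstar) P :=
    ((memLp_two_iff_integrable_sq_norm (hm wstar)).2 hN).integrable one_le_two
  refine (h.norm.add (integrable_const (L * ‖v - wstar‖))).mono' (hm v) (ae_of_all _ fun x => ?_)
  exact (hs x).norm_gradient_le v wstar

/-- Differentiation under the integral: on the unit ball around `v` the Lipschitz bound gives the
integrable majorant `‖∇f(v; x)‖ + L`. -/
lemma gradient_risk (hL : 0 ≤ L) (hf : ∀ v, Measurable fun x => f x v)
    (hint : ∀ v, Integrable (fun x => f x v) P) (hs : ∀ x, IsSmooth L (f x))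
    (hN : Integrable (fun x => ‖gradient (f x) wstar‖ ^ 2) P) (v : Vec d) :
    gradient (risk P f) v = ∫ x, gradient (f x) v ∂P := by
  have hnorm : ∀ x z, ‖fderiv ℝ (f x) z‖ = ‖gradient (f x) z‖ := fun x z => by
    simp [gradient]
  have hmeas : AEStronglyMeasurable (fun x => fderiv ℝ (f x) v) P := by
    have h := (InnerProductSpace.toDual ℝ (Vec d)).continuous.comp_aestronglyMeasurable
      (integrable_gradient hf hs hN v).aestronglyMeasurable
    simpa [gradient] using h
  have hbound : Integrable (fun x => ‖gradient (f x) v‖ + L) P :=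
    (integrable_gradient hf hs hN v).norm.add (integrable_const L)
  have hle : ∀ x, ∀ z ∈ Metric.ball v 1, ‖fderiv ℝ (f x) z‖ ≤ ‖gradient (f x) v‖ + L := by
    intro x z hz
    rw [hnorm]
    refine ((hs x).norm_gradient_le z v).trans ?_
    have : ‖z - v‖ ≤ 1 := by simpa [dist_eq_norm] using hz.le
    nlinarith
  have hd : HasFDerivAt (fun z => ∫ x, f x z ∂P) (∫ x, fderiv ℝ (f x) v ∂P) v :=
    hasFDerivAt_integral_of_dominated_of_fderiv_le (F' := fun z x => fderiv ℝ (f x) z)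
      (Metric.ball_mem_nhds v one_pos)
      (Eventually.of_forall fun z => (hf z).aestronglyMeasurable) (hint v) hmeas
      (ae_of_all _ hle) hbound (ae_of_all _ fun x z _ => ((hs x).1 z).hasFDerivAt)
  have hi : Integrable (fun x => fderiv ℝ (f x) v) P :=
    hbound.mono' hmeas (ae_of_all _ fun x => hle x v (Metric.mem_ball_self one_pos))
  refine ext_inner_right ℝ fun z => ?_
  rw [inner_gradient, show risk P f = fun z => ∫ x, f x z ∂P from rfl, hd.fderiv,
    ContinuousLinearMap.integral_apply hi, real_inner_comm,
    ← integral_inner (integrable_gradient hf hs hN v)]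
  refine integral_congr_ae (ae_of_all _ fun x => ?_)
  simp only
  rw [real_inner_comm, inner_gradient]

lemma norm_gradient_risk_sub_le (hL : 0 ≤ L) (hf : ∀ v, Measurable fun x => f x v)
    (hint : ∀ v, Integrable (fun x => f x v) P) (hs : ∀ x, IsSmooth L (f x))
    (hN : Integrable (fun x => ‖gradient (f x) wstar‖ ^ 2) P) (v v' : Vec d) :
    ‖gradient (risk P f) v - gradient (risk P f) v'‖ ≤ L * ‖v - v'‖ := by
  rw [gradient_risk hL hf hint hs hN, gradient_risk hL hf hint hs hN,
    ← integral_sub (integrable_gradient hf hs hN v) (integrable_gradient hf hs hN v')]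
  refine (norm_integral_le_of_norm_le_const (ae_of_all _ fun x => (hs x).2 v v')).trans ?_
  simp

lemma integral_norm_gradient_sq_le (hf : ∀ v, Measurable fun x => f x v)
    (hs : ∀ x, IsSmooth L (f x)) (hN : Integrable (fun x => ‖gradient (f x) wstar‖ ^ 2) P)
    (v : Vec d) :
    Integrable (fun x => ‖gradient (f x) v‖ ^ 2) P ∧
    ∫ x, ‖gradient (f x) v‖ ^ 2 ∂P ≤
      2 * L ^ 2 * ‖v - wstar‖ ^ 2 + 2 * ∫ x, ‖gradient (f x) wstar‖ ^ 2 ∂P := by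
  have hi : Integrable (fun x => 2 * L ^ 2 * ‖v - wstar‖ ^ 2 + 2 * ‖gradient (f x) wstar‖ ^ 2) P :=
    (integrable_const _).add (hN.const_mul 2)
  have hi' : Integrable (fun x => ‖gradient (f x) v‖ ^ 2) P := by
    refine hi.mono' ?_ (ae_of_all _ fun x => ?_)
    · exact ((measurable_gradient hf (fun x => (hs x).1) v).norm.pow_const 2).aestronglyMeasurable
    · rw [Real.norm_of_nonneg (sq_nonneg _)]
      exact (hs x).norm_gradient_sq_le v wstar
  refine ⟨hi', ?_⟩
  calc ∫ x, ‖gradient (f x) v‖ ^ 2 ∂P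
      ≤ ∫ x, (2 * L ^ 2 * ‖v - wstar‖ ^ 2 + 2 * ‖gradient (f x) wstar‖ ^ 2) ∂P :=
        integral_mono hi' hi fun x => (hs x).norm_gradient_sq_le v wstar
    _ = _ := by
      rw [integral_add (integrable_const _) (hN.const_mul 2), integral_const_mul (2 : ℝ)]
      simp

end Risk

/-! ### Strong convexity with gradients read at a different point. -/

section StrongConvexity

variable {d : ℕ} {F : Vec d → ℝ} {μ : ℝ} {wstar : Vec d}

lemma gradient_eq_zero_of_isMin (h : ∀ v, F wstar ≤ F v) : gradient F wstar = 0 := by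
  have : IsLocalMin F wstar := Eventually.of_forall h
  simp [gradient, this.fderiv_eq_zero]

/-- The strong convexity inequalities for the two orders of `v` and `wstar` add up, each
contributing `μ/2`. -/
lemma IsStronglyConvex.le_inner_gradient (hF : IsStronglyConvex μ F) (h : ∀ v, F wstar ≤ F v)
    (v : Vec d) : μ * ‖v - wstar‖ ^ 2 ≤ inner ℝ (v - wstar) (gradient F v) := by
  have h1 := hF.2 v wstar
  have h2 := hF.2 wstar v
  rw [gradient_eq_zero_of_isMin h, inner_zero_left] at h1
  rw [← neg_sub v wstar, inner_neg_right, norm_neg] at h2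
  rw [real_inner_comm]
  linarith

/-- The one-step inequality for a step taken at `v` with a gradient read at `v'`. -/
lemma IsStronglyConvex.neg_inner_gradient_le {L η : ℝ} (hμ : 0 < μ) (hη : 0 ≤ η)
    (hF : IsStronglyConvex μ F) (h : ∀ v, F wstar ≤ F v)
    (hLip : ∀ v v', ‖gradient F v - gradient F v'‖ ≤ L * ‖v - v'‖) (v v' : Vec d) :
    -(2 * η) * inner ℝ (v - wstar) (gradient F v') + η * μ / 2 * ‖v' - wstar‖ ^ 2 ≤
      -(μ * η / 2) * ‖v - wstar‖ ^ 2 + η * (4 * L ^ 2 / μ + 5 / 4 * μ) * ‖v' - v‖ ^ 2 := by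
  have hmono := hF.le_inner_gradient h v'
  have hb : inner ℝ (v' - v) (gradient F v') ≤ ‖v' - v‖ * (L * ‖v' - wstar‖) := by
    refine (real_inner_le_norm _ _).trans ?_
    gcongr
    have := hLip v' wstar
    rwa [gradient_eq_zero_of_isMin h, sub_zero] at this
  have hsplit : inner ℝ (v - wstar) (gradient F v') =
      inner ℝ (v' - wstar) (gradient F v') - inner ℝ (v' - v) (gradient F v') := by
    rw [← inner_sub_left]; congr 1; abel
  -- Of the `2 μ ‖v' - wstar‖²` supplied by `hmono`, Young spends `μ/4` and the statement reserves
  -- `μ/2`. The remaining `5/4 μ` is converted by `htri` into at least `μ/2` of `‖v - wstar‖²`, at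
  -- the cost of `5/4 μ ‖v' - v‖²`.
  have hyoung : 2 * (‖v' - v‖ * (L * ‖v' - wstar‖)) ≤
      μ / 4 * ‖v' - wstar‖ ^ 2 + 4 * L ^ 2 / μ * ‖v' - v‖ ^ 2 := by
    have : μ / 4 * ‖v' - wstar‖ ^ 2 + 4 * L ^ 2 / μ * ‖v' - v‖ ^ 2 -
        2 * (‖v' - v‖ * (L * ‖v' - wstar‖)) =
        (μ * ‖v' - wstar‖ - 4 * L * ‖v' - v‖) ^ 2 / (4 * μ) := by
      field_simp; ring
    have : 0 ≤ (μ * ‖v' - wstar‖ - 4 * L * ‖v' - v‖) ^ 2 / (4 * μ) := by positivity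
    linarith
  have htri : ‖v - wstar‖ ^ 2 ≤ 2 * ‖v' - wstar‖ ^ 2 + 2 * ‖v' - v‖ ^ 2 := by
    have h1 : ‖v - wstar‖ ≤ ‖v' - wstar‖ + ‖v' - v‖ := by
      rw [show v - wstar = (v' - wstar) - (v' - v) by abel]
      exact norm_sub_le _ _
    have h2 : ‖v - wstar‖ ^ 2 ≤ (‖v' - wstar‖ + ‖v' - v‖) ^ 2 := by gcongr
    nlinarith [sq_nonneg (‖v' - wstar‖ - ‖v' - v‖)]
  rw [hsplit]
  have key : 2 * inner ℝ (v' - v) (gradient F v') - 2 * inner ℝ (v' - wstar) (gradient F v') +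
      μ / 2 * ‖v' - wstar‖ ^ 2 ≤ -(μ / 2) * ‖v - wstar‖ ^ 2 +
      (4 * L ^ 2 / μ + 5 / 4 * μ) * ‖v' - v‖ ^ 2 := by
    have h1 : 0 ≤ μ * ‖v - wstar‖ ^ 2 := by positivity
    have h2 := mul_le_mul_of_nonneg_left htri hμ.le
    linarith
  have := mul_le_mul_of_nonneg_left key hη
  linarith

end StrongConvexity

/-! ### The joint law of a sample and its filter index. -/

section SampleLaw

variable {d : ℕ} {Ξ Ω : Type*} [MeasurableSpace Ξ] [MeasurableSpace Ω] {P : Measure Ξ}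
  {ρ : Measure Ω} {f : Ξ → Vec d → ℝ} {D τ : ℕ} {S : Ξ → ℕ → Finset (Fin d)} {η : ℕ → ℝ}
  {w₀ : Vec d} {ξ : ℕ → Ω → Ξ} {u : ℕ → Ω → ℕ} {mask : ℕ → ℕ → Ω → Fin d → Bool}
  {w what : ℕ → Ω → Vec d}

/-- The joint law of a sample and of the index of its filter. -/
noncomputable def sampleLaw (P : Measure Ξ) (f : Ξ → Vec d → ℝ) (D : ℕ) : Measure (Ξ × ℕ) :=
  ∑ k ∈ Finset.range D, (P.withDensity fun x => filterProb D (f x) k).map fun x => (x, k)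

lemma IsRun.measurable_pair (h : IsRun P f D S τ η w₀ ρ ξ u mask w what) (t : ℕ) :
    Measurable fun ω => (ξ t ω, u t ω) :=
  (h.measurable_sample t).prodMk (h.measurable_index t)

/-- Slicing an event by the countably many index values reduces it to the law of the run; indices
from `D` on have probability zero. -/
lemma IsRun.map_pair (h : IsRun P f D S τ η w₀ ρ ξ u mask w what) (hD : 1 ≤ D) (t : ℕ) :
    ρ.map (fun ω => (ξ t ω, u t ω)) = sampleLaw P f D := by
  ext s hs
  have hsec : ∀ k : ℕ, MeasurableSet {x | (x, k) ∈ s} := fun k => measurable_prodMk_right hs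
  have hpre : (fun ω => (ξ t ω, u t ω)) ⁻¹' s =
      ⋃ k : ℕ, {ω | ξ t ω ∈ {x | (x, k) ∈ s} ∧ u t ω = k} := by
    ext ω; simp
  rw [Measure.map_apply (h.measurable_pair t) hs, hpre, measure_iUnion]
  · simp_rw [h.law t _ (hsec _)]
    rw [tsum_eq_sum (s := Finset.range D), sampleLaw, Measure.finsetSum_apply]
    · refine Finset.sum_congr rfl fun k _ => ?_
      rw [Measure.map_apply measurable_prodMk_right hs]
      exact (withDensity_apply _ (hsec k)).symm
    · intro k hk
      simp [filterProb_eq_zero hD _ (not_lt.1 fun h => hk (Finset.mem_range.2 h))]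
  · intro k l hkl
    refine Set.disjoint_left.2 fun ω hk hl => hkl ?_
    exact hk.2.symm.trans hl.2
  · intro k
    exact (h.measurable_sample t (hsec k)).inter (h.measurable_index t (measurableSet_singleton k))

lemma integrable_filterProb_smul {E : Type*} [NormedAddCommGroup E] [NormedSpace ℝ E]
    (hS : IsFilterFamily D f S) (k : ℕ) {g : Ξ → E} (hg : Integrable g P) :
    Integrable (fun x => (filterProb D (f x) k).toReal • g x) P := by
  refine MeasureTheory.Integrable.bdd_smul hg 1
    (hS.measurable_filterProb k).ennreal_toReal.aestronglyMeasurable (ae_of_all _ fun x => ?_)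
  rw [Real.norm_of_nonneg ENNReal.toReal_nonneg]
  exact ENNReal.toReal_le_of_le_ofReal zero_le_one (by simpa using filterProb_le_one _ _)

lemma integral_sampleLaw {E : Type*} [NormedAddCommGroup E] [NormedSpace ℝ E]
    [MeasurableSpace E] [BorelSpace E] [SecondCountableTopology E]
    (hS : IsFilterFamily D f S) {g : Ξ × ℕ → E} (hg : Measurable g)
    (hi : ∀ k, Integrable (fun x => g (x, k)) P) :
    Integrable g (sampleLaw P f D) ∧ ∫ z, g z ∂(sampleLaw P f D) =
      ∫ x, ∑ k ∈ Finset.range D, (filterProb D (f x) k).toReal • g (x, k) ∂P := by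
  have hlt : ∀ k, ∀ᵐ x ∂P, filterProb D (f x) k < ∞ := fun k =>
    ae_of_all _ fun x => (filterProb_le_one _ _).trans_lt ENNReal.one_lt_top
  have hk : ∀ k, Integrable g ((P.withDensity fun x => filterProb D (f x) k).map
      fun x => (x, k)) := fun k => by
    rw [integrable_map_measure hg.aestronglyMeasurable measurable_prodMk_right.aemeasurable,
      integrable_withDensity_iff_integrable_smul' (hS.measurable_filterProb k) (hlt k)]
    exact integrable_filterProb_smul hS k (hi k)
  refine ⟨integrable_finsetSum_measure.2 fun k _ => hk k, ?_⟩
  rw [sampleLaw, integral_finsetSum_measure fun k _ => hk k,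
    integral_finsetSum _ fun k _ => integrable_filterProb_smul hS k (hi k)]
  refine Finset.sum_congr rfl fun k _ => ?_
  rw [integral_map measurable_prodMk_right.aemeasurable hg.aestronglyMeasurable,
    integral_withDensity_eq_integral_toReal_smul (hS.measurable_filterProb k) (hlt k)]

lemma IsRun.integral_pair {E : Type*} [NormedAddCommGroup E] [NormedSpace ℝ E]
    [MeasurableSpace E] [BorelSpace E] [SecondCountableTopology E]
    (h : IsRun P f D S τ η w₀ ρ ξ u mask w what) (hD : 1 ≤ D)
    (hS : IsFilterFamily D f S) {g : Ξ × ℕ → E} (hg : Measurable g)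
    (hi : ∀ k, Integrable (fun x => g (x, k)) P) (t : ℕ) :
    Integrable (fun ω => g (ξ t ω, u t ω)) ρ ∧ ∫ ω, g (ξ t ω, u t ω) ∂ρ =
      ∫ x, ∑ k ∈ Finset.range D, (filterProb D (f x) k).toReal • g (x, k) ∂P := by
  have h1 := integral_sampleLaw hS hg hi
  rw [← h.map_pair hD t, integral_map (h.measurable_pair t).aemeasurable hg.aestronglyMeasurable,
    integrable_map_measure hg.aestronglyMeasurable (h.measurable_pair t).aemeasurable] at h1
  exact h1

end SampleLaw

/-! ### Adaptedness of iterates and reads to the past. -/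

section Measurability

variable {d : ℕ} {Ξ Ω : Type*} [MeasurableSpace Ξ] [mΩ : MeasurableSpace Ω] {P : Measure Ξ}
  {ρ : Measure Ω} {f : Ξ → Vec d → ℝ} {D τ : ℕ} {S : Ξ → ℕ → Finset (Fin d)} {η : ℕ → ℝ} {L : ℝ}
  {w₀ : Vec d} {ξ : ℕ → Ω → Ξ} {u : ℕ → Ω → ℕ} {mask : ℕ → ℕ → Ω → Fin d → Bool}
  {w what : ℕ → Ω → Vec d}

lemma measurable_pair_past {Ω : Type*} {ξ : ℕ → Ω → Ξ} {u : ℕ → Ω → ℕ}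
    {mask : ℕ → ℕ → Ω → Fin d → Bool} {j t : ℕ} (hj : j < t) :
    Measurable[past τ ξ u mask t] fun ω => (ξ j ω, u j ω) :=
  (comap_measurable _).mono
    ((le_iSup₂ (f := fun j (_ : j ∈ Finset.range t) =>
      MeasurableSpace.comap (fun ω => (ξ j ω, u j ω)) inferInstance) j
      (Finset.mem_range.2 hj)).trans le_sup_left) le_rfl

lemma measurable_mask_past {Ω : Type*} {ξ : ℕ → Ω → Ξ} {u : ℕ → Ω → ℕ}
    {mask : ℕ → ℕ → Ω → Fin d → Bool} {s j t : ℕ} (hs : s ≤ t) (hj : j ∈ Finset.Ico (s - τ) s) :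
    Measurable[past τ ξ u mask t] (mask s j) :=
  (comap_measurable _).mono
    ((le_iSup₂_of_le (f := fun s (_ : s ∈ Finset.range (t + 1)) => ⨆ j ∈ Finset.Ico (s - τ) s,
      MeasurableSpace.comap (mask s j) inferInstance) s (Finset.mem_range.2 (Nat.lt_succ_of_le hs))
      (le_iSup₂ (f := fun j (_ : j ∈ Finset.Ico (s - τ) s) =>
        MeasurableSpace.comap (mask s j) inferInstance) j hj)).trans le_sup_right) le_rfl

lemma past_mono {Ω : Type*} {ξ : ℕ → Ω → Ξ} {u : ℕ → Ω → ℕ}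
    {mask : ℕ → ℕ → Ω → Fin d → Bool} {s t : ℕ} (h : s ≤ t) : past τ ξ u mask s ≤ past τ ξ u mask t := by
  refine sup_le (iSup₂_le fun j hj => ?_) (iSup₂_le fun r hr => iSup₂_le fun j hj => ?_)
  · exact (measurable_pair_past ((Finset.mem_range.1 hj).trans_le h)).comap_le
  · exact (measurable_mask_past ((Nat.lt_succ_iff.1 (Finset.mem_range.1 hr)).trans h) hj).comap_le

lemma IsRun.past_le (h : IsRun P f D S τ η w₀ ρ ξ u mask w what) (t : ℕ) :
    past τ ξ u mask t ≤ mΩ :=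
  sup_le (iSup₂_le fun j _ => (h.measurable_pair j).comap_le)
    (iSup₂_le fun r _ => iSup₂_le fun j _ => (h.measurable_mask r j).comap_le)

lemma measurable_restrict_mask {X : Type*} {mX : MeasurableSpace X} {m : X → Fin d → Bool}
    {g : X → Vec d} (hm : Measurable m)
    (hg : Measurable g) :
    Measurable fun ω => restrict (Finset.univ.filter fun i => m ω i = true) (g ω) := by
  refine measurable_vec fun i => ?_
  simp only [restrict_apply, Finset.mem_filter, Finset.mem_univ, true_and]
  refine Measurable.ite ?_ (measurable_vec_apply hg i) measurable_const
  exact ((measurable_pi_apply i).comp hm) (measurableSet_singleton true)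

lemma IsFilterFamily.measurable_direction_comp {X : Type*} {m : MeasurableSpace X}
    (hS : IsFilterFamily D f S) (hf : ∀ v, Measurable fun x => f x v)
    (hs : ∀ x, IsSmooth L (f x)) {a : X → Ξ} {k : X → ℕ} {b : X → Vec d}
    (hak : Measurable fun x => (a x, k x)) (hb : Measurable b) :
    Measurable fun x => direction D f S (a x) (k x) (b x) := by
  have h := Measurable.comp (hS.measurable_direction hf hs) (hak.prodMk hb)
  exact h

lemma IsRun.measurable_past (h : IsRun P f D S τ η w₀ ρ ξ u mask w what)
    (hS : IsFilterFamily D f S) (hf : ∀ v, Measurable fun x => f x v)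
    (hs : ∀ x, IsSmooth L (f x)) (t : ℕ) :
    Measurable[past τ ξ u mask t] (w t) ∧ Measurable[past τ ξ u mask t] (what t) := by
  induction t using Nat.strong_induction_on with
  | _ t ih =>
  have hdir : ∀ j < t, Measurable[past τ ξ u mask t]
      fun ω => direction D f S (ξ j ω) (u j ω) (what j ω) := fun j hj =>
    hS.measurable_direction_comp hf hs (measurable_pair_past hj)
      ((ih j hj).2.mono (past_mono hj.le) le_rfl)
  have hw : Measurable[past τ ξ u mask t] (w t) := by
    cases t with
    | zero =>
      rw [show w 0 = fun _ => w₀ from funext h.start]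
      exact measurable_const
    | succ s =>
      rw [show w (s + 1) = _ from funext (h.step s)]
      exact ((ih s s.lt_succ_self).1.mono (past_mono s.le_succ) le_rfl).sub
        ((hdir s s.lt_succ_self).const_smul (η s))
  refine ⟨hw, ?_⟩
  rw [show what t = _ from funext (h.read t)]
  refine Measurable.sub ?_ ?_
  -- When `t - τ = t`, the base point of the read is `w t` itself, which the induction hypothesis
  -- does not cover but `hw` does.
  · rcases (Nat.sub_le t τ).eq_or_lt with h' | h'
    · rwa [h']
    · exact (ih _ h').1.mono (past_mono h'.le) le_rfl
  · refine Finset.measurable_sum _ fun j hj => Measurable.const_smul ?_ (η j)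
    exact measurable_restrict_mask (measurable_mask_past le_rfl hj)
      (hdir j (Finset.mem_Ico.1 hj).2)

lemma IsRun.measurable_iterate (h : IsRun P f D S τ η w₀ ρ ξ u mask w what)
    (hS : IsFilterFamily D f S) (hf : ∀ v, Measurable fun x => f x v)
    (hs : ∀ x, IsSmooth L (f x)) (t : ℕ) : Measurable (w t) ∧ Measurable (what t) :=
  ⟨(h.measurable_past hS hf hs t).1.mono (h.past_le t) le_rfl,
    (h.measurable_past hS hf hs t).2.mono (h.past_le t) le_rfl⟩

lemma IsRun.measurable_step (h : IsRun P f D S τ η w₀ ρ ξ u mask w what)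
    (hS : IsFilterFamily D f S) (hf : ∀ v, Measurable fun x => f x v)
    (hs : ∀ x, IsSmooth L (f x)) (t : ℕ) :
    Measurable fun ω => direction D f S (ξ t ω) (u t ω) (what t ω) :=
  hS.measurable_direction_comp hf hs (h.measurable_pair t) (h.measurable_iterate hS hf hs t).2

end Measurability

/-! ### Finite second moments. -/

section Integrability

variable {d : ℕ} {Ξ Ω : Type*} [MeasurableSpace Ξ] [MeasurableSpace Ω] {P : Measure Ξ}
  {ρ : Measure Ω} [IsProbabilityMeasure ρ]
  {f : Ξ → Vec d → ℝ} {D τ : ℕ} {S : Ξ → ℕ → Finset (Fin d)} {η : ℕ → ℝ} {L : ℝ}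
  {wstar w₀ : Vec d} {ξ : ℕ → Ω → Ξ} {u : ℕ → Ω → ℕ} {mask : ℕ → ℕ → Ω → Fin d → Bool}
  {w what : ℕ → Ω → Vec d}

/-- The gradient grows at most linearly away from `wstar`, where it is square integrable, so second
moments pass from the read to the update. -/
lemma IsRun.memLp_step_of_read (h : IsRun P f D S τ η w₀ ρ ξ u mask w what) (hD : 1 ≤ D)
    (hS : IsFilterFamily D f S) (hf : ∀ v, Measurable fun x => f x v)
    (hs : ∀ x, IsSmooth L (f x)) (hN : Integrable (fun x => ‖gradient (f x) wstar‖ ^ 2) P)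
    {t : ℕ} (ht : MemLp (what t) 2 ρ) :
    MemLp (fun ω => direction D f S (ξ t ω) (u t ω) (what t ω)) 2 ρ := by
  have hgm : Measurable fun x => gradient (f x) wstar :=
    measurable_gradient hf (fun x => (hs x).1) wstar
  have hgrad : MemLp (fun ω => gradient (f (ξ t ω)) wstar) 2 ρ := by
    refine (memLp_two_iff_integrable_sq_norm
      (hgm.comp (h.measurable_sample t)).aestronglyMeasurable).2 ?_
    exact (h.integral_pair hD hS (g := fun z => ‖gradient (f z.1) wstar‖ ^ 2)
      ((hgm.comp measurable_fst).norm.pow_const 2) (fun _ => hN) t).1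
  have hsum : MemLp (fun ω => (D : ℝ) *
      (‖gradient (f (ξ t ω)) wstar‖ + L * ‖what t ω - wstar‖)) 2 ρ :=
    (hgrad.norm.add ((ht.sub (memLp_const wstar)).norm.const_mul L)).const_mul (D : ℝ)
  refine hsum.mono (h.measurable_step hS hf hs t).aestronglyMeasurable (ae_of_all _ fun ω => ?_)
  refine (norm_direction_le _ _ _).trans ((mul_le_mul_of_nonneg_left
    ((hs _).norm_gradient_le _ wstar) (Nat.cast_nonneg D)).trans (le_abs_self _))

lemma IsRun.memLp_iterate (h : IsRun P f D S τ η w₀ ρ ξ u mask w what) (hD : 1 ≤ D)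
    (hS : IsFilterFamily D f S) (hf : ∀ v, Measurable fun x => f x v)
    (hs : ∀ x, IsSmooth L (f x)) (hN : Integrable (fun x => ‖gradient (f x) wstar‖ ^ 2) P)
    (t : ℕ) : MemLp (w t) 2 ρ ∧ MemLp (what t) 2 ρ := by
  induction t using Nat.strong_induction_on with
  | _ t ih =>
  have hdir := fun j (hj : j < t) => h.memLp_step_of_read hD hS hf hs hN (ih j hj).2
  have hw : MemLp (w t) 2 ρ := by
    cases t with
    | zero =>
      rw [show w 0 = fun _ => w₀ from funext h.start]
      exact memLp_const _
    | succ s =>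
      rw [show w (s + 1) = _ from funext (h.step s)]
      exact (ih s s.lt_succ_self).1.sub ((hdir s s.lt_succ_self).const_smul (η s))
  refine ⟨hw, ?_⟩
  rw [show what t = _ from funext (h.read t)]
  refine MemLp.sub ?_ (memLp_finsetSum _ fun j hj => MemLp.const_smul ?_ (η j))
  · rcases (Nat.sub_le t τ).eq_or_lt with h' | h'
    · rwa [h']
    · exact (ih _ h').1
  · have hj' := (Finset.mem_Ico.1 hj).2
    exact (hdir j hj').mono (measurable_restrict_mask (h.measurable_mask t j)
      (h.measurable_step hS hf hs j)).aestronglyMeasurable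
      (ae_of_all _ fun ω => norm_restrict_le _ _)

lemma IsRun.memLp_step (h : IsRun P f D S τ η w₀ ρ ξ u mask w what) (hD : 1 ≤ D)
    (hS : IsFilterFamily D f S) (hf : ∀ v, Measurable fun x => f x v)
    (hs : ∀ x, IsSmooth L (f x)) (hN : Integrable (fun x => ‖gradient (f x) wstar‖ ^ 2) P)
    (t : ℕ) : MemLp (fun ω => direction D f S (ξ t ω) (u t ω) (what t ω)) 2 ρ :=
  h.memLp_step_of_read hD hS hf hs hN (h.memLp_iterate hD hS hf hs hN t).2

end Integrability

/-! ### Averaging over the fresh sample. -/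

section Conditioning

lemma integrable_inner_of_memLp_two {Ω E : Type*} [MeasurableSpace Ω] {ρ : Measure Ω}
    [NormedAddCommGroup E] [InnerProductSpace ℝ E] {a b : Ω → E} (ha : MemLp a 2 ρ)
    (hb : MemLp b 2 ρ) : Integrable (fun ω => (inner ℝ (a ω) (b ω) : ℝ)) ρ :=
  (ha.norm.integrable_mul hb.norm).mono' (ha.1.inner hb.1)
    (ae_of_all _ fun _ => norm_inner_le_norm _ _)

/-- Fubini for the product law replaces conditional expectation: freeze the past, then average over
the sample. -/
lemma integral_of_indepFun {Ω β γ : Type*} [MeasurableSpace Ω] [MeasurableSpace β]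
    [MeasurableSpace γ] {ρ : Measure Ω} [IsProbabilityMeasure ρ] {X : Ω → β} {Z : Ω → γ}
    (hX : Measurable X) (hZ : Measurable Z) (hXZ : IndepFun X Z ρ) {g : β × γ → ℝ}
    (hg : Measurable g) (hi : Integrable (fun ω => g (X ω, Z ω)) ρ) :
    ∫ ω, g (X ω, Z ω) ∂ρ = ∫ ω, ∫ z, g (X ω, z) ∂(ρ.map Z) ∂ρ := by
  have hmap := (indepFun_iff_map_prod_eq_prod_map_map hX.aemeasurable hZ.aemeasurable).1 hXZ
  have : IsProbabilityMeasure (ρ.map X) := Measure.isProbabilityMeasure_map hX.aemeasurable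
  have : IsProbabilityMeasure (ρ.map Z) := Measure.isProbabilityMeasure_map hZ.aemeasurable
  have hi' : Integrable g ((ρ.map X).prod (ρ.map Z)) := by
    rw [← hmap, integrable_map_measure hg.aestronglyMeasurable (hX.prodMk hZ).aemeasurable]
    exact hi
  rw [← integral_map (hX.prodMk hZ).aemeasurable hg.aestronglyMeasurable, hmap,
    integral_prod _ hi', integral_map hX.aemeasurable]
  exact hg.stronglyMeasurable.integral_prod_right'.aestronglyMeasurable

variable {d : ℕ} {Ξ Ω : Type*} [MeasurableSpace Ξ] [MeasurableSpace Ω] {P : Measure Ξ}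
  {ρ : Measure Ω}
  {f : Ξ → Vec d → ℝ} {D τ : ℕ} {S : Ξ → ℕ → Finset (Fin d)} {η : ℕ → ℝ} {L : ℝ}
  {wstar w₀ : Vec d} {ξ : ℕ → Ω → Ξ} {u : ℕ → Ω → ℕ} {mask : ℕ → ℕ → Ω → Fin d → Bool}
  {w what : ℕ → Ω → Vec d}

lemma IsRun.indepFun (h : IsRun P f D S τ η w₀ ρ ξ u mask w what)
    (hS : IsFilterFamily D f S) (hf : ∀ v, Measurable fun x => f x v)
    (hs : ∀ x, IsSmooth L (f x)) (t : ℕ) :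
    IndepFun (fun ω => (w t ω, what t ω)) (fun ω => (ξ t ω, u t ω)) ρ := by
  rw [IndepFun_iff_Indep]
  refine indep_of_indep_of_le_left (h.indep t) ?_
  exact ((h.measurable_past hS hf hs t).1.prodMk (h.measurable_past hS hf hs t).2).comap_le

variable [IsProbabilityMeasure P]

lemma integrable_direction (hS : IsFilterFamily D f S) (hf : ∀ v, Measurable fun x => f x v)
    (hs : ∀ x, IsSmooth L (f x)) (hN : Integrable (fun x => ‖gradient (f x) wstar‖ ^ 2) P)
    (v : Vec d) (k : ℕ) :
    Integrable (fun x => direction D f S x k v) P ∧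
      Integrable (fun x => ‖direction D f S x k v‖ ^ 2) P := by
  have hm : Measurable fun x => direction D f S x k v :=
    hS.measurable_direction_comp hf hs measurable_prodMk_right measurable_const
  refine ⟨((integrable_gradient hf hs hN v).norm.const_mul (D : ℝ)).mono' hm.aestronglyMeasurable
    (ae_of_all _ fun x => norm_direction_le _ _ _),
    ((integral_norm_gradient_sq_le hf hs hN v).1.const_mul ((D : ℝ) ^ 2)).mono'
      (hm.norm.pow_const 2).aestronglyMeasurable (ae_of_all _ fun x => ?_)⟩
  rw [Real.norm_of_nonneg (sq_nonneg _), ← mul_pow]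
  gcongr
  exact norm_direction_le _ _ _

variable [IsProbabilityMeasure ρ]

lemma IsRun.integral_norm_step_sq_le (h : IsRun P f D S τ η w₀ ρ ξ u mask w what) (hD : 1 ≤ D)
    (hS : IsFilterFamily D f S) (hf : ∀ v, Measurable fun x => f x v)
    (hs : ∀ x, IsSmooth L (f x)) (hN : Integrable (fun x => ‖gradient (f x) wstar‖ ^ 2) P)
    (t : ℕ) :
    ∫ ω, ‖direction D f S (ξ t ω) (u t ω) (what t ω)‖ ^ 2 ∂ρ ≤
      D * (2 * L ^ 2 * ∫ ω, ‖what t ω - wstar‖ ^ 2 ∂ρ +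
        2 * ∫ x, ‖gradient (f x) wstar‖ ^ 2 ∂P) := by
  obtain ⟨hw, hwh⟩ := h.measurable_iterate hS hf hs t
  have hwi : Integrable (fun ω => ‖what t ω - wstar‖ ^ 2) ρ :=
    ((h.memLp_iterate hD hS hf hs hN t).2.sub (memLp_const wstar)).integrable_norm_pow two_ne_zero
  have hg : Measurable fun p : (Vec d × Vec d) × (Ξ × ℕ) =>
      ‖direction D f S p.2.1 p.2.2 p.1.2‖ ^ 2 :=
    (hS.measurable_direction_comp hf hs measurable_snd
      (measurable_snd.comp measurable_fst)).norm.pow_const 2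
  rw [integral_of_indepFun (hw.prodMk hwh) (h.measurable_pair t) (h.indepFun hS hf hs t) hg
    ((h.memLp_step hD hS hf hs hN t).integrable_norm_pow two_ne_zero), h.map_pair hD t]
  have hinner : ∀ v : Vec d, ∫ z, ‖direction D f S z.1 z.2 v‖ ^ 2 ∂(sampleLaw P f D) ≤
      D * (2 * L ^ 2 * ‖v - wstar‖ ^ 2 + 2 * ∫ x, ‖gradient (f x) wstar‖ ^ 2 ∂P) := by
    intro v
    have hi := fun k => (integrable_direction hS hf hs hN v k).2
    obtain ⟨hgi, hgle⟩ := integral_norm_gradient_sq_le hf hs hN v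
    rw [(integral_sampleLaw (g := fun z => ‖direction D f S z.1 z.2 v‖ ^ 2) hS
      ((hS.measurable_direction_comp hf hs measurable_id measurable_const).norm.pow_const 2) hi).2]
    calc _ ≤ ∫ x, D * ‖gradient (f x) v‖ ^ 2 ∂P :=
          integral_mono (integrable_finsetSum _ fun k _ => integrable_filterProb_smul hS k (hi k))
            (hgi.const_mul (D : ℝ)) fun x => sum_filterProb_smul_norm_direction_sq hD hS x v
      _ ≤ _ := by
        rw [integral_const_mul (D : ℝ)]
        gcongr
  calc _ ≤ ∫ ω, D * (2 * L ^ 2 * ‖what t ω - wstar‖ ^ 2 +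
        2 * ∫ x, ‖gradient (f x) wstar‖ ^ 2 ∂P) ∂ρ :=
        integral_mono_of_nonneg (ae_of_all _ fun ω => integral_nonneg fun z => by positivity)
          (((hwi.const_mul _).add (integrable_const _)).const_mul _)
          (ae_of_all _ fun ω => hinner _)
    _ = _ := by
      rw [integral_const_mul (D : ℝ), integral_add (hwi.const_mul _) (integrable_const _),
        integral_const_mul (2 * L ^ 2)]
      simp

lemma IsRun.integral_inner_step (h : IsRun P f D S τ η w₀ ρ ξ u mask w what) (hD : 1 ≤ D)
    (hL : 0 ≤ L) (hS : IsFilterFamily D f S) (hf : ∀ v, Measurable fun x => f x v)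
    (hint : ∀ v, Integrable (fun x => f x v) P)
    (hs : ∀ x, IsSmooth L (f x)) (hN : Integrable (fun x => ‖gradient (f x) wstar‖ ^ 2) P)
    (t : ℕ) :
    ∫ ω, inner ℝ (w t ω - wstar) (direction D f S (ξ t ω) (u t ω) (what t ω)) ∂ρ =
      ∫ ω, inner ℝ (w t ω - wstar) (gradient (risk P f) (what t ω)) ∂ρ := by
  obtain ⟨hw, hwh⟩ := h.measurable_iterate hS hf hs t
  have hg : Measurable fun p : (Vec d × Vec d) × (Ξ × ℕ) =>
      (inner ℝ (p.1.1 - wstar) (direction D f S p.2.1 p.2.2 p.1.2) : ℝ) :=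
    ((measurable_fst.comp measurable_fst).sub_const wstar).inner
      (hS.measurable_direction_comp hf hs measurable_snd (measurable_snd.comp measurable_fst))
  rw [integral_of_indepFun (hw.prodMk hwh) (h.measurable_pair t) (h.indepFun hS hf hs t) hg
    (integrable_inner_of_memLp_two
      ((h.memLp_iterate hD hS hf hs hN t).1.sub (memLp_const wstar))
      (h.memLp_step hD hS hf hs hN t)), h.map_pair hD t]
  refine integral_congr_ae (ae_of_all _ fun ω => ?_)
  simp only
  generalize w t ω - wstar = c
  generalize what t ω = v
  have hi := fun k => (integrable_direction hS hf hs hN v k).1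
  have hdm : Measurable fun z : Ξ × ℕ => direction D f S z.1 z.2 v :=
    hS.measurable_direction_comp hf hs measurable_id measurable_const
  obtain ⟨h1, h2⟩ := integral_sampleLaw (P := P) hS hdm hi
  rw [integral_inner h1, h2, gradient_risk hL hf hint hs hN]
  simp only [sum_filterProb_smul_direction hD hS]

end Conditioning

/-! ### Recursive inequalities for the mean square errors. -/

section Recursion

variable {d : ℕ} {Ξ Ω : Type*} [MeasurableSpace Ξ] [MeasurableSpace Ω] {P : Measure Ξ}
  {ρ : Measure Ω} {f : Ξ → Vec d → ℝ} {D τ : ℕ} {S : Ξ → ℕ → Finset (Fin d)} {η : ℕ → ℝ}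
  {L μ : ℝ} {wstar w₀ : Vec d} {ξ : ℕ → Ω → Ξ} {u : ℕ → Ω → ℕ}
  {mask : ℕ → ℕ → Ω → Fin d → Bool} {w what : ℕ → Ω → Vec d}

lemma norm_sub_restrict_le (s : Finset (Fin d)) (v : Vec d) : ‖v - restrict s v‖ ≤ ‖v‖ := by
  have : v - restrict s v = restrict sᶜ v := by
    ext i
    by_cases hi : i ∈ s <;> simp [hi]
  rw [this]
  exact norm_restrict_le _ _

lemma IsRun.iterate_eq (h : IsRun P f D S τ η w₀ ρ ξ u mask w what) {s t : ℕ} (hst : s ≤ t)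
    (ω : Ω) : w t ω = w s ω -
      ∑ j ∈ Finset.Ico s t, η j • direction D f S (ξ j ω) (u j ω) (what j ω) := by
  induction t, hst using Nat.le_induction with
  | base => simp
  | succ t hst ih => rw [h.step, ih, Finset.sum_Ico_succ_top hst, sub_sub]

/-- The difference consists of the masked-out parts of at most `τ` updates. A masked-out part is no
longer than the whole update, whatever the mask, and Cauchy–Schwarz gives the factor `τ`. -/
lemma IsRun.norm_read_sub_sq_le (h : IsRun P f D S τ η w₀ ρ ξ u mask w what) (t : ℕ) (ω : Ω) :
    ‖what t ω - w t ω‖ ^ 2 ≤ τ * ∑ j ∈ Finset.Ico (t - τ) t,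
      η j ^ 2 * ‖direction D f S (ξ j ω) (u j ω) (what j ω)‖ ^ 2 := by
  rw [h.read, h.iterate_eq (Nat.sub_le t τ), sub_sub_sub_cancel_left, ← Finset.sum_sub_distrib]
  simp only [← smul_sub]
  refine (pow_le_pow_left₀ (norm_nonneg _) (norm_sum_le_of_le _ fun j _ =>
    (norm_smul_le _ _).trans (mul_le_mul_of_nonneg_left (norm_sub_restrict_le _ _)
      (norm_nonneg _))) 2).trans (sq_sum_le_card_mul_sum_sq.trans ?_)
  simp only [mul_pow, Real.norm_eq_abs, sq_abs]
  gcongr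
  rw [Nat.card_Ico]
  omega

variable [IsProbabilityMeasure ρ]

lemma IsRun.integral_norm_read_sq_le (h : IsRun P f D S τ η w₀ ρ ξ u mask w what)
    (hD : 1 ≤ D) (hS : IsFilterFamily D f S) (hf : ∀ v, Measurable fun x => f x v)
    (hs : ∀ x, IsSmooth L (f x)) (hN : Integrable (fun x => ‖gradient (f x) wstar‖ ^ 2) P)
    (t : ℕ) :
    ∫ ω, ‖what t ω - wstar‖ ^ 2 ∂ρ ≤
      2 * ∫ ω, ‖w t ω - wstar‖ ^ 2 ∂ρ + 2 * ∫ ω, ‖what t ω - w t ω‖ ^ 2 ∂ρ := by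
  obtain ⟨hw, hwh⟩ := h.memLp_iterate hD hS hf hs hN t
  have h1 : Integrable (fun ω => 2 * ‖w t ω - wstar‖ ^ 2) ρ :=
    ((hw.sub (memLp_const wstar)).integrable_norm_pow two_ne_zero).const_mul 2
  have h2 : Integrable (fun ω => 2 * ‖what t ω - w t ω‖ ^ 2) ρ :=
    ((hwh.sub hw).integrable_norm_pow two_ne_zero).const_mul 2
  rw [← integral_const_mul (2 : ℝ), ← integral_const_mul (2 : ℝ), ← integral_add h1 h2]
  refine integral_mono ((hwh.sub (memLp_const wstar)).integrable_norm_pow two_ne_zero)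
    (h1.add h2) fun ω => ?_
  have h3 : ‖what t ω - wstar‖ ≤ ‖w t ω - wstar‖ + ‖what t ω - w t ω‖ := by
    rw [show what t ω - wstar = (w t ω - wstar) + (what t ω - w t ω) by abel]
    exact norm_add_le _ _
  have h4 := pow_le_pow_left₀ (norm_nonneg _) h3 2
  show ‖what t ω - wstar‖ ^ 2 ≤ 2 * ‖w t ω - wstar‖ ^ 2 + 2 * ‖what t ω - w t ω‖ ^ 2
  nlinarith [sq_nonneg (‖w t ω - wstar‖ - ‖what t ω - w t ω‖)]

variable [IsProbabilityMeasure P]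

lemma IsRun.integral_norm_read_sub_sq_le (h : IsRun P f D S τ η w₀ ρ ξ u mask w what)
    (hD : 1 ≤ D) (hS : IsFilterFamily D f S) (hf : ∀ v, Measurable fun x => f x v)
    (hs : ∀ x, IsSmooth L (f x)) (hN : Integrable (fun x => ‖gradient (f x) wstar‖ ^ 2) P)
    (t : ℕ) :
    ∫ ω, ‖what t ω - w t ω‖ ^ 2 ∂ρ ≤ τ * ∑ j ∈ Finset.Ico (t - τ) t, η j ^ 2 *
      (D * (2 * L ^ 2 * ∫ ω, ‖what j ω - wstar‖ ^ 2 ∂ρ +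
        2 * ∫ x, ‖gradient (f x) wstar‖ ^ 2 ∂P)) := by
  obtain ⟨hw, hwh⟩ := h.memLp_iterate hD hS hf hs hN t
  have hi := fun j => ((h.memLp_step hD hS hf hs hN j).integrable_norm_pow two_ne_zero).const_mul
    (η j ^ 2)
  refine (integral_mono ((hwh.sub hw).integrable_norm_pow two_ne_zero)
    ((integrable_finsetSum _ fun j _ => hi j).const_mul (τ : ℝ))
    (h.norm_read_sub_sq_le t)).trans ?_
  rw [integral_const_mul (τ : ℝ), integral_finsetSum _ fun j _ => hi j]
  gcongr with j _
  rw [integral_const_mul (η j ^ 2)]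
  gcongr
  exact h.integral_norm_step_sq_le hD hS hf hs hN j

lemma IsRun.integral_norm_succ_sq_le (h : IsRun P f D S τ η w₀ ρ ξ u mask w what)
    (hD : 1 ≤ D) (hL : 0 ≤ L) (hμ : 0 < μ) (hS : IsFilterFamily D f S)
    (hf : ∀ v, Measurable fun x => f x v) (hint : ∀ v, Integrable (fun x => f x v) P)
    (hF : IsStronglyConvex μ (risk P f)) (hmin : ∀ v, risk P f wstar ≤ risk P f v)
    (hs : ∀ x, IsSmooth L (f x)) (hN : Integrable (fun x => ‖gradient (f x) wstar‖ ^ 2) P)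
    (t : ℕ) (hη : 0 ≤ η t) (hηL : η t * (4 * L ^ 2 * D) ≤ μ) :
    ∫ ω, ‖w (t + 1) ω - wstar‖ ^ 2 ∂ρ ≤ (1 - μ * η t / 2) * ∫ ω, ‖w t ω - wstar‖ ^ 2 ∂ρ +
      η t * (4 * L ^ 2 / μ + 5 / 4 * μ) * ∫ ω, ‖what t ω - w t ω‖ ^ 2 ∂ρ +
      η t ^ 2 * (D * (2 * ∫ x, ‖gradient (f x) wstar‖ ^ 2 ∂P)) := by
  obtain ⟨hw, hwh⟩ := h.memLp_iterate hD hS hf hs hN t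
  have hdir := h.memLp_step hD hS hf hs hN t
  have hx := hw.sub (memLp_const wstar)
  have hy := hwh.sub (memLp_const wstar)
  have ix := hx.integrable_norm_pow two_ne_zero
  have iy := hy.integrable_norm_pow two_ne_zero
  have iδ := (hwh.sub hw).integrable_norm_pow two_ne_zero
  have ig := hdir.integrable_norm_pow two_ne_zero
  have ixg := integrable_inner_of_memLp_two hx hdir
  have hLip := norm_gradient_risk_sub_le hL hf hint hs hN
  have hG : MemLp (fun ω => gradient (risk P f) (what t ω)) 2 ρ := by
    refine (hy.norm.const_mul L).mono ?_ (ae_of_all _ fun ω => ?_)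
    · have hcont : Continuous (gradient (risk P f)) :=
        (show IsSmooth L (risk P f) from ⟨hF.1, hLip⟩).continuous_gradient
      exact hcont.comp_aestronglyMeasurable hwh.1
    · have := hLip (what t ω) wstar
      rw [gradient_eq_zero_of_isMin hmin, sub_zero] at this
      exact this.trans (le_abs_self _)
  have ixG := integrable_inner_of_memLp_two hx hG
  have hexp : ∫ ω, ‖w (t + 1) ω - wstar‖ ^ 2 ∂ρ = ∫ ω, ‖w t ω - wstar‖ ^ 2 ∂ρ -
      2 * η t * ∫ ω, inner ℝ (w t ω - wstar) (gradient (risk P f) (what t ω)) ∂ρ +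
      η t ^ 2 * ∫ ω, ‖direction D f S (ξ t ω) (u t ω) (what t ω)‖ ^ 2 ∂ρ := by
    rw [← h.integral_inner_step hD hL hS hf hint hs hN t, ← integral_const_mul (2 * η t),
      ← integral_const_mul (η t ^ 2)]
    refine Eq.trans ?_ (integral_add (ix.sub (ixg.const_mul (2 * η t)))
      (ig.const_mul (η t ^ 2))) |>.trans (by
        congr 1; exact integral_sub ix (ixg.const_mul (2 * η t)))
    refine integral_congr_ae (ae_of_all _ fun ω => ?_)
    simp only [Pi.sub_apply]
    rw [h.step, sub_right_comm, norm_sub_sq_real, norm_smul, inner_smul_right, mul_pow,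
      Real.norm_eq_abs, sq_abs]
    ring
  have hone : -(2 * η t) * ∫ ω, inner ℝ (w t ω - wstar) (gradient (risk P f) (what t ω)) ∂ρ +
      η t * μ / 2 * ∫ ω, ‖what t ω - wstar‖ ^ 2 ∂ρ ≤
      -(μ * η t / 2) * ∫ ω, ‖w t ω - wstar‖ ^ 2 ∂ρ +
      η t * (4 * L ^ 2 / μ + 5 / 4 * μ) * ∫ ω, ‖what t ω - w t ω‖ ^ 2 ∂ρ := by
    simp only [← integral_const_mul]
    refine (integral_add (ixG.const_mul _) (iy.const_mul _)).symm.trans_le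
      (le_trans ?_ (integral_add (ix.const_mul _) (iδ.const_mul _)).le)
    exact integral_mono ((ixG.const_mul _).add (iy.const_mul _))
      ((ix.const_mul _).add (iδ.const_mul _)) fun ω =>
      hF.neg_inner_gradient_le hμ hη hmin hLip (w t ω) (what t ω)
  have htwo := mul_le_mul_of_nonneg_left (h.integral_norm_step_sq_le hD hS hf hs hN t)
    (sq_nonneg (η t))
  have hy0 : 0 ≤ ∫ ω, ‖what t ω - wstar‖ ^ 2 ∂ρ := integral_nonneg fun ω => by positivity
  -- Half of this inequality absorbs the `2 L² D η²` multiple of the read error from `htwo` into the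
  -- `η μ / 2` multiple in `hone`.
  have hthree := mul_le_mul_of_nonneg_right (mul_le_mul_of_nonneg_left hηL hη) hy0
  rw [hexp]
  linarith

end Recursion

/-! ### The expected number of entry updates. -/

section Updates

variable {d : ℕ} {Ξ Ω : Type*} [MeasurableSpace Ξ] [MeasurableSpace Ω] {P : Measure Ξ}
  {ρ : Measure Ω}
  {f : Ξ → Vec d → ℝ} {D τ : ℕ} {S : Ξ → ℕ → Finset (Fin d)} {η : ℕ → ℝ}
  {w₀ : Vec d} {ξ : ℕ → Ω → Ξ} {u : ℕ → Ω → ℕ}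
  {mask : ℕ → ℕ → Ω → Fin d → Bool} {w what : ℕ → Ω → Vec d}

lemma deltaBar_div (hD : 1 ≤ D) (t : ℝ) : t * deltaBar P f D / D =
    t * ∫ x, (⌈((gradSupport (f x)).card : ℝ) / D⌉₊ : ℝ) ∂P := by
  have : (D : ℝ) ≠ 0 := by positivity
  rw [deltaBar]
  field_simp

variable [IsProbabilityMeasure P]

lemma IsRun.integral_numUpdates (h : IsRun P f D S τ η w₀ ρ ξ u mask w what)
    (hD : 1 ≤ D) (hS : IsFilterFamily D f S) (t : ℕ) :
    Integrable (fun ω => (numUpdates S ξ u t ω : ℝ)) ρ ∧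
    ∫ ω, (numUpdates S ξ u t ω : ℝ) ∂ρ =
      t * ∫ x, ((max 1 (numFilters D (f x)) : ℕ) : ℝ)⁻¹ * (gradSupport (f x)).card ∂P := by
  have hg : Measurable fun z : Ξ × ℕ => ((S z.1 z.2).card : ℝ) :=
    (measurable_from_top (f := fun n : ℕ => (n : ℝ))).comp hS.measurable_card
  have hi : ∀ k, Integrable (fun x => ((S x k).card : ℝ)) P := fun k =>
    Integrable.of_bound (hg.comp measurable_prodMk_right).aestronglyMeasurable (d : ℝ)
      (ae_of_all _ fun x => by
        rw [Real.norm_natCast]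
        exact_mod_cast (Finset.card_le_univ _).trans_eq (Fintype.card_fin d))
  have hj := h.integral_pair hD hS hg hi
  simp only [sum_filterProb_smul_card hD hS] at hj
  simp only [numUpdates, Nat.cast_sum]
  refine ⟨integrable_finsetSum _ fun j _ => (hj j).1, ?_⟩
  rw [integral_finsetSum _ fun j _ => (hj j).1, Finset.sum_congr rfl fun j _ => (hj j).2]
  simp

lemma integral_card_div_le (hD : 1 ≤ D) (hS : IsFilterFamily D f S) :
    ∫ x, ((max 1 (numFilters D (f x)) : ℕ) : ℝ)⁻¹ * (gradSupport (f x)).card ∂P ≤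
      ∫ x, (⌈((gradSupport (f x)).card : ℝ) / D⌉₊ : ℝ) ∂P := by
  have hD' : (0 : ℝ) < D := by exact_mod_cast hD
  refine integral_mono_of_nonneg (ae_of_all _ fun x => by positivity) ?_
    (ae_of_all _ fun x => card_div_le_ceil hD (f x))
  refine Integrable.of_bound ((measurable_from_top (f := fun n : ℕ =>
    ((⌈(n : ℝ) / D⌉₊ : ℕ) : ℝ))).comp hS.measurable_card_gradSupport).aestronglyMeasurable (d : ℝ)
    (ae_of_all _ fun x => ?_)
  rw [Real.norm_natCast]
  have h1 : (gradSupport (f x)).card ≤ d := (Finset.card_le_univ _).trans_eq (Fintype.card_fin d)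
  refine Nat.cast_le.2 (Nat.ceil_le.2 ?_)
  rw [div_le_iff₀ hD']
  exact_mod_cast h1.trans (Nat.le_mul_of_pos_right d hD)

end Updates

/-! ### Deterministic sequences: Grönwall and the rate. -/

section Sequences

/-- Discrete Grönwall: each step multiplies the left side by at most `1 + c * g t ≤ exp (c * g t)`.
-/
lemma add_mul_sum_le_mul_exp {c₀ c : ℝ} (hc : 0 ≤ c) {g y : ℕ → ℝ}
    (hg : ∀ t, 0 ≤ g t) (hy : ∀ t, y t ≤ c₀ + c * ∑ j ∈ Finset.range t, g j * y j) (hc₀ : 0 ≤ c₀)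
    (t : ℕ) :
    c₀ + c * ∑ j ∈ Finset.range t, g j * y j ≤ c₀ * Real.exp (c * ∑ j ∈ Finset.range t, g j) := by
  induction t with
  | zero => simp
  | succ t ih =>
    rw [Finset.sum_range_succ, Finset.sum_range_succ, mul_add c (∑ j ∈ Finset.range t, g j),
      Real.exp_add]
    have h1 : c * (g t * y t) ≤ c * g t * (c₀ + c * ∑ j ∈ Finset.range t, g j * y j) := by
      rw [mul_assoc]
      exact mul_le_mul_of_nonneg_left (mul_le_mul_of_nonneg_left (hy t) (hg t)) hc
    have hcg : 0 ≤ c * g t := mul_nonneg hc (hg t)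
    have h2 := Real.add_one_le_exp (c * g t)
    have h3 : 0 ≤ c₀ * Real.exp (c * ∑ j ∈ Finset.range t, g j) := by positivity
    have h4 := mul_le_mul_of_nonneg_left ih hcg
    have h5 := mul_le_mul_of_nonneg_left h2 h3
    linarith

/-- After exchanging the sums, each `j` is counted only for `s` in `(j, j + τ]`. -/
lemma sum_sum_Ico_sub_le {g : ℕ → ℝ} (hg : ∀ t, 0 ≤ g t) (τ t : ℕ) :
    ∑ s ∈ Finset.range t, ∑ j ∈ Finset.Ico (s - τ) s, g j ≤
      τ * ∑ j ∈ Finset.range t, g j := by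
  rw [Finset.sum_comm' (t' := Finset.range t)
    (s' := fun j => (Finset.range t).filter fun s => j ∈ Finset.Ico (s - τ) s), Finset.mul_sum]
  · refine Finset.sum_le_sum fun j _ => ?_
    rw [Finset.sum_const, nsmul_eq_mul]
    refine mul_le_mul_of_nonneg_right (Nat.cast_le.2 ?_) (hg j)
    calc _ ≤ (Finset.Ioc j (j + τ)).card := Finset.card_le_card fun s hs => by
          simp only [Finset.mem_filter, Finset.mem_Ico, Finset.mem_Ioc] at hs ⊢
          omega
      _ = τ := by simp
  · intro s j
    simp only [Finset.mem_filter, Finset.mem_range, Finset.mem_Ico]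
    omega

lemma exists_sum_one_div_sq_le {E : ℝ} (hE : 0 < E) :
    ∃ Q : ℝ, ∀ t : ℕ, ∑ j ∈ Finset.range t, (1 / (j + E)) ^ 2 ≤ Q := by
  have hsum : Summable fun j : ℕ => (1 / ((j : ℝ) + E)) ^ 2 := by
    refine ((Real.summable_one_div_nat_add_rpow E 2).2 one_lt_two).congr fun j => ?_
    rw [abs_of_pos (by positivity), Real.rpow_two, one_div_pow]
  exact ⟨_, fun t => hsum.sum_le_tsum _ fun j _ => by positivity⟩

lemma sum_one_div_add_le {E : ℝ} (hE : 0 < E) (t : ℕ) :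
    ∑ s ∈ Finset.range t, 1 / ((s : ℝ) + E) ≤ 1 / E + 1 + Real.log t := by
  have h1 : ∑ s ∈ Finset.range t, 1 / ((s : ℝ) + E) ≤
      ∑ s ∈ Finset.range (t + 1), 1 / ((s : ℝ) + E) := by
    rw [Finset.sum_range_succ]
    have : 0 ≤ 1 / ((t : ℝ) + E) := by positivity
    linarith
  have h2 : ∑ s ∈ Finset.range t, 1 / (((s + 1 : ℕ) : ℝ) + E) ≤ (harmonic t : ℝ) := by
    rw [harmonic]
    push_cast
    refine Finset.sum_le_sum fun s _ => ?_
    rw [one_div]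
    exact inv_anti₀ (by positivity) (by linarith)
  rw [Finset.sum_range_succ'] at h1
  have h3 := harmonic_le_one_add_log t
  simp only [Nat.cast_zero, zero_add] at h1
  linarith

/-- The scalar recursions behind the convergence rate: `e` and `e'` are the errors of the iterates
and of the reads, and `δ` is the error caused by the delay. -/
structure IsDelayedRecursion (E K A a b : ℝ) (τ : ℕ) (e e' δ : ℕ → ℝ) : Prop where
  nonneg : ∀ t, 0 ≤ e t
  nonneg_read : ∀ t, 0 ≤ e' t
  step : ∀ t : ℕ, e (t + 1) ≤ (1 - 2 * (1 / (t + E))) * e t + K * (1 / (t + E)) * δ t +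
    A * (1 / (t + E)) ^ 2
  delay : ∀ t : ℕ, δ t ≤ ∑ j ∈ Finset.Ico (t - τ) t, (1 / (j + E)) ^ 2 * (a * e' j + b)
  read : ∀ t, e' t ≤ 2 * e t + 2 * δ t

variable {E K A a b R : ℝ} {τ : ℕ}

/-- The contraction is discarded here: summability of the squared steps alone suffices. Grönwall is
applied to `1 + e' t`, which absorbs the additive constants. -/
lemma IsDelayedRecursion.exists_bound (hE : 0 < E) (hK : 0 ≤ K) (hA : 0 ≤ A) (ha : 0 ≤ a)
    (hb : 0 ≤ b) : ∃ B : ℝ, 0 ≤ B ∧ ∀ e e' δ : ℕ → ℝ, IsDelayedRecursion E K A a b τ e e' δ →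
      e 0 = R ^ 2 → ∀ t, e' t ≤ B := by
  obtain ⟨Q, hQ⟩ := exists_sum_one_div_sq_le hE
  set c₁ : ℝ := A + K * (1 / E) * ((a + b) * τ) with hc₁
  set c₂ : ℝ := 2 * c₁ + 2 * (a + b) with hc₂
  have hc₁0 : 0 ≤ c₁ := by positivity
  have hc₂0 : 0 ≤ c₂ := by positivity
  refine ⟨(1 + 2 * R ^ 2) * Real.exp (c₂ * Q), by positivity, fun e e' δ h h0 t => ?_⟩
  set g : ℕ → ℝ := fun j => (1 / (j + E)) ^ 2 with hg
  have hg0 : ∀ j, 0 ≤ g j := fun j => sq_nonneg _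
  have hδ : ∀ t, δ t ≤ (a + b) * ∑ j ∈ Finset.Ico (t - τ) t, g j * (1 + e' j) := fun t => by
    refine (h.delay t).trans ?_
    rw [Finset.mul_sum]
    refine Finset.sum_le_sum fun j _ => ?_
    have h1 : a * e' j + b ≤ (a + b) * (1 + e' j) := by
      nlinarith [mul_nonneg hb (h.nonneg_read j)]
    have := mul_le_mul_of_nonneg_left h1 (hg0 j)
    calc _ ≤ _ := this
      _ = _ := by ring
  have hgy : ∀ j, 0 ≤ g j * (1 + e' j) := fun j =>
    mul_nonneg (hg0 j) (by linarith [h.nonneg_read j])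
  have hstep : ∀ t, e (t + 1) ≤ e t + K * (1 / E) * ((a + b) *
      ∑ j ∈ Finset.Ico (t - τ) t, g j * (1 + e' j)) + A * (g t * (1 + e' t)) := fun t => by
    have h1 : 0 ≤ 1 / ((t : ℝ) + E) * e t := mul_nonneg (by positivity) (h.nonneg t)
    have h2 : K * (1 / ((t : ℝ) + E)) * δ t ≤ K * (1 / E) * ((a + b) *
        ∑ j ∈ Finset.Ico (t - τ) t, g j * (1 + e' j)) := by
      have h3 : 0 ≤ (a + b) * ∑ j ∈ Finset.Ico (t - τ) t, g j * (1 + e' j) :=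
        mul_nonneg (by positivity) (Finset.sum_nonneg fun j _ => hgy j)
      refine (mul_le_mul_of_nonneg_left (hδ t) (by positivity)).trans
        (mul_le_mul_of_nonneg_right (mul_le_mul_of_nonneg_left ?_ hK) h3)
      gcongr
      simp
    have h4 : A * g t ≤ A * (g t * (1 + e' t)) := by
      refine mul_le_mul_of_nonneg_left ?_ hA
      nlinarith [mul_nonneg (hg0 t) (h.nonneg_read t)]
    have := h.step t
    simp only [hg] at h4 ⊢
    linarith
  have he : ∀ t, e t ≤ R ^ 2 + K * (1 / E) * ((a + b) * ∑ s ∈ Finset.range t,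
      ∑ j ∈ Finset.Ico (s - τ) s, g j * (1 + e' j)) +
      A * ∑ j ∈ Finset.range t, g j * (1 + e' j) := fun t => by
    induction t with
    | zero => simp [h0]
    | succ t ih =>
      rw [Finset.sum_range_succ, Finset.sum_range_succ]
      linarith [hstep t]
  have he' : ∀ t, e t ≤ R ^ 2 + c₁ * ∑ j ∈ Finset.range t, g j * (1 + e' j) := fun t => by
    have h1 := mul_le_mul_of_nonneg_left (sum_sum_Ico_sub_le hgy τ t)
      (show 0 ≤ K * (1 / E) * (a + b) by positivity)
    rw [hc₁]
    linarith [he t]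
  have hy : ∀ t, 1 + e' t ≤ (1 + 2 * R ^ 2) + c₂ * ∑ j ∈ Finset.range t, g j * (1 + e' j) :=
    fun t => by
      have h1 : ∑ j ∈ Finset.Ico (t - τ) t, g j * (1 + e' j) ≤
          ∑ j ∈ Finset.range t, g j * (1 + e' j) :=
        Finset.sum_le_sum_of_subset_of_nonneg
          (fun j hj => Finset.mem_range.2 (Finset.mem_Ico.1 hj).2) fun j _ _ => hgy j
      have h2 := mul_le_mul_of_nonneg_left h1 (show 0 ≤ a + b by positivity)
      rw [hc₂]
      linarith [he' t, hδ t, h.read t]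
  have hfin := add_mul_sum_le_mul_exp hc₂0 hg0 hy (by positivity) t
  have hexp : (1 + 2 * R ^ 2) * Real.exp (c₂ * ∑ j ∈ Finset.range t, g j) ≤
      (1 + 2 * R ^ 2) * Real.exp (c₂ * Q) := by
    gcongr
    exact hQ t
  linarith [hy t]

lemma IsDelayedRecursion.exists_rate (hE : 0 < E) (hK : 0 ≤ K) (hA : 0 ≤ A) (ha : 0 ≤ a)
    (hb : 0 ≤ b) : ∃ C : ℝ, ∀ e e' δ : ℕ → ℝ, IsDelayedRecursion E K A a b τ e e' δ →
      e 0 = R ^ 2 → ∀ t : ℕ, 2 ≤ t →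
        e' t ≤ 4 * A * (t / (t + E - 1) ^ 2) + C * (Real.log t / (t + E - 1) ^ 2) ∧
        e t ≤ 4 * A * (t / (t + E - 1) ^ 2) + C * (Real.log t / (t + E - 1) ^ 2) := by
  obtain ⟨B, hB, hbound⟩ := exists_bound (R := R) (τ := τ) hE hK hA ha hb
  -- For `j ≥ t - τ`, `1/(j+E)` is at most `q/(t+E)`; this holds for every `E > 0`, without `E ≥
  -- 2τ`.
  set q : ℝ := 1 + τ / E with hq
  set c : ℝ := τ * ((q ^ 2) * (a * B + b)) with hc
  have hc0 : 0 ≤ c := by positivity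
  set C₀ : ℝ := (E - 1) ^ 2 * R ^ 2 + K * c * (1 / E + 1) with hC₀
  have hC₀0 : 0 ≤ C₀ := by positivity
  have hlog2 : 0 < Real.log 2 := Real.log_pos one_lt_two
  -- Since `t ≥ 2`, constants are absorbed into `log t` through division by `log 2`; the factors `2`
  -- come from the read inequality.
  refine ⟨2 * (C₀ / Real.log 2 + K * c) + 2 * c / Real.log 2, fun e e' δ h h0 t ht => ?_⟩
  have hδ : ∀ t : ℕ, δ t ≤ c * (1 / (t + E)) ^ 2 := fun t => by
    refine (h.delay t).trans ?_
    have hterm : ∀ j ∈ Finset.Ico (t - τ) t, (1 / ((j : ℝ) + E)) ^ 2 * (a * e' j + b) ≤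
        q ^ 2 * (a * B + b) * (1 / (t + E)) ^ 2 := fun j hj => by
      have hjt : (t : ℝ) ≤ j + τ := by
        have := (Finset.mem_Ico.1 hj).1
        exact_mod_cast (by omega : t ≤ j + τ)
      have h1 : 1 / ((j : ℝ) + E) ≤ q * (1 / (t + E)) := by
        rw [mul_one_div, div_le_div_iff₀ (by positivity) (by positivity), one_mul]
        have h2 : (τ : ℝ) ≤ τ / E * (j + E) := by
          rw [div_mul_eq_mul_div, le_div_iff₀ hE]
          gcongr
          simp
        rw [hq]
        linarith
      have h3 : a * e' j + b ≤ a * B + b := by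
        gcongr
        exact hbound e e' δ h h0 j
      have h4 : 0 ≤ a * e' j + b := add_nonneg (mul_nonneg ha (h.nonneg_read j)) hb
      calc _ ≤ (q * (1 / (t + E))) ^ 2 * (a * B + b) := by gcongr
        _ = _ := by ring
    refine (Finset.sum_le_card_nsmul _ _ _ hterm).trans ?_
    rw [nsmul_eq_mul, Nat.card_Ico, hc, mul_assoc (τ : ℝ)]
    gcongr
    omega
  -- The weight is chosen so that `(t+E)² (1 - 2/(t+E)) = (t+E-1)² - 1`; the leftover `-e t` is
  -- dropped, and the coefficient of `e t` may have either sign.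
  have hT : ∀ t : ℕ, (t + E - 1) ^ 2 * e t ≤ (E - 1) ^ 2 * R ^ 2 + A * t +
      K * c * ∑ s ∈ Finset.range t, 1 / ((s : ℝ) + E) := fun t => by
    induction t with
    | zero => simp [h0]
    | succ t ih =>
      have hp : 0 < (t : ℝ) + E := by positivity
      have h1 : e (t + 1) ≤ (1 - 2 * (1 / (t + E))) * e t +
          K * (1 / (t + E)) * (c * (1 / (t + E)) ^ 2) + A * (1 / (t + E)) ^ 2 := by
        have := mul_le_mul_of_nonneg_left (hδ t) (show 0 ≤ K * (1 / ((t : ℝ) + E)) by positivity)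
        linarith [h.step t]
      have h2 := mul_le_mul_of_nonneg_left h1 (sq_nonneg ((t : ℝ) + E))
      have h3 : ((t : ℝ) + E) ^ 2 * ((1 - 2 * (1 / (t + E))) * e t +
          K * (1 / (t + E)) * (c * (1 / (t + E)) ^ 2) + A * (1 / (t + E)) ^ 2) =
          (t + E - 1) ^ 2 * e t - e t + K * c * (1 / (t + E)) + A := by
        field_simp
        ring
      rw [Finset.sum_range_succ]
      push_cast
      rw [show (t : ℝ) + 1 + E - 1 = t + E by ring]
      linarith [h.nonneg t]
  have ht2 : (2 : ℝ) ≤ t := by exact_mod_cast ht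
  have hp : 0 < (t : ℝ) + E - 1 := by linarith
  have hlog : Real.log 2 ≤ Real.log t := Real.log_le_log two_pos ht2
  have hconst : ∀ x : ℝ, 0 ≤ x → x ≤ x / Real.log 2 * Real.log t := fun x hx => by
    rw [div_mul_eq_mul_div, le_div_iff₀ hlog2]
    gcongr
  have hTt : (t + E - 1) ^ 2 * e t ≤ A * t + (C₀ / Real.log 2 + K * c) * Real.log t := by
    have h1 := mul_le_mul_of_nonneg_left (sum_one_div_add_le hE t)
      (show 0 ≤ K * c by positivity)
    have h2 := hconst C₀ hC₀0
    rw [hC₀] at h2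
    linarith [hT t]
  have hTe : (t + E - 1) ^ 2 * e' t ≤ 2 * ((t + E - 1) ^ 2 * e t) + 2 * c := by
    have h1 : ((t : ℝ) + E - 1) ^ 2 * (c * (1 / (t + E)) ^ 2) ≤ c := by
      have h2 : ((t : ℝ) + E - 1) * (1 / (t + E)) ≤ 1 := by
        rw [mul_one_div, div_le_one (by positivity)]
        linarith
      have h3 : (((t : ℝ) + E - 1) * (1 / (t + E))) ^ 2 ≤ 1 :=
        pow_le_one₀ (by positivity) h2
      nlinarith [mul_le_mul_of_nonneg_left h3 hc0]
    have h4 := mul_le_mul_of_nonneg_left ((h.read t).trans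
      (add_le_add_right (mul_le_mul_of_nonneg_left (hδ t) two_pos.le) _))
      (sq_nonneg ((t : ℝ) + E - 1))
    linarith
  have hc2 := hconst c hc0
  have hAt : 0 ≤ A * t := by positivity
  have hlog0 : 0 ≤ (C₀ / Real.log 2 + K * c) * Real.log t :=
    mul_nonneg (by positivity) (hlog2.le.trans hlog)
  have hclog : 2 * c / Real.log 2 * Real.log t = 2 * (c / Real.log 2 * Real.log t) := by ring
  rw [mul_div_assoc', mul_div_assoc', ← add_div, le_div_iff₀ (by positivity),
    le_div_iff₀ (by positivity)]
  constructor <;> linarith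

lemma isDelayedRecursion_of_stepSize {c μ G M N : ℝ} {η e e' δ : ℕ → ℝ} (hG : 0 ≤ G)
    (hM : 0 ≤ M) (hN : 0 ≤ N) (hK : 0 ≤ K) (hη : ∀ t, 0 ≤ η t)
    (hle : ∀ t : ℕ, η t ≤ c * (1 / (t + E))) (hge : ∀ t : ℕ, 2 * (1 / (t + E)) ≤ μ * η t / 2)
    (he : ∀ t, 0 ≤ e t) (he' : ∀ t, 0 ≤ e' t) (hδ : ∀ t, 0 ≤ δ t)
    (hstep : ∀ t, e (t + 1) ≤ (1 - μ * η t / 2) * e t + η t * K * δ t + η t ^ 2 * (G * N))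
    (hdelay : ∀ t, δ t ≤ τ * ∑ j ∈ Finset.Ico (t - τ) t, η j ^ 2 * (G * (M * e' j + N)))
    (hread : ∀ t, e' t ≤ 2 * e t + 2 * δ t) :
    IsDelayedRecursion E (K * c) (c ^ 2 * (G * N)) (τ * c ^ 2 * (G * M)) (τ * c ^ 2 * (G * N)) τ
      e e' δ := by
  have hsq : ∀ t : ℕ, η t ^ 2 ≤ c ^ 2 * (1 / (t + E)) ^ 2 := fun t => by
    rw [← mul_pow]
    exact pow_le_pow_left₀ (hη t) (hle t) 2
  refine ⟨he, he', fun t => ?_, fun t => (hdelay t).trans ?_, hread⟩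
  · have h1 := mul_le_mul_of_nonneg_right (hge t) (he t)
    have h2 := mul_le_mul_of_nonneg_right (hle t) (mul_nonneg hK (hδ t))
    have h3 := mul_le_mul_of_nonneg_right (hsq t) (mul_nonneg hG hN)
    linarith [hstep t]
  · rw [Finset.mul_sum]
    refine Finset.sum_le_sum fun j _ => ?_
    have h1 := mul_le_mul_of_nonneg_left (mul_le_mul_of_nonneg_right (hsq j)
      (mul_nonneg hG (add_nonneg (mul_nonneg hM (he' j)) hN))) (Nat.cast_nonneg (α := ℝ) τ)
    linarith

end Sequences

end Hogwild

/-! ### Assembly of the rate and the update count. -/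

theorem theorem6
    (μ L α E N R : ℝ) (D τ : ℕ) (hμ : 0 < μ) (hL : 0 < L) (hD : 1 ≤ D) (hα : 4 ≤ α)
    (hE : 4 * L * (L / μ) * α * D / μ ≤ E) :
    -- the constant of the `O`-term, depending on the parameters above alone
    ∃ C : ℝ,
      ∀ (d : ℕ) (Ξ Ω : Type*) [MeasurableSpace Ξ] [MeasurableSpace Ω]
        (P : Measure Ξ) [IsProbabilityMeasure P] (ρ : Measure Ω) [IsProbabilityMeasure ρ]
        (f : Ξ → Hogwild.Vec d → ℝ) (wstar w₀ : Hogwild.Vec d)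
        (S : Ξ → ℕ → Finset (Fin d)) (a : ℕ → ℝ)
        (ξ : ℕ → Ω → Ξ) (u : ℕ → Ω → ℕ) (mask : ℕ → ℕ → Ω → Fin d → Bool)
        (w what : ℕ → Ω → Hogwild.Vec d),
        -- the objective is well defined, strongly convex, with smooth components
        (∀ v, Measurable fun x => f x v) →
        (∀ v, Integrable (fun x => f x v) P) →
        Hogwild.IsStronglyConvex μ (Hogwild.risk P f) →
        (∀ x, Hogwild.IsSmooth L (f x)) →
        -- the minimizer, the (finite) gradient noise `N` there, and the initial distance `R`
        (∀ v, Hogwild.risk P f wstar ≤ Hogwild.risk P f v) →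
        Integrable (fun x => ‖gradient (f x) wstar‖ ^ 2) P →
        N = 2 * ∫ x, ‖gradient (f x) wstar‖ ^ 2 ∂P →
        R = ‖w₀ - wstar‖ →
        -- the algorithm, with step sizes `η_t = α_t / (μ (t + E))`
        Hogwild.IsFilterFamily D f S →
        (∀ t, 4 ≤ a t ∧ a t ≤ α) →
        Hogwild.IsRun P f D S τ (fun t => a t / (μ * (t + E))) w₀ ρ ξ u mask w what →
        -- the expected number of single vector entry updates
        (∀ t : ℕ,
          Integrable (fun ω => (Hogwild.numUpdates S ξ u t ω : ℝ)) ρ ∧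
          ∫ ω, (Hogwild.numUpdates S ξ u t ω : ℝ) ∂ρ ≤ t * Hogwild.deltaBar P f D / D ∧
          ((∀ᵐ x ∂P, (Hogwild.gradSupport (f x)).card ≤ D ∨
              D ∣ (Hogwild.gradSupport (f x)).card) →
            ∫ ω, (Hogwild.numUpdates S ξ u t ω : ℝ) ∂ρ = t * Hogwild.deltaBar P f D / D)) ∧
        -- the convergence rate, for both the vectors read and the iterates
        (∀ t : ℕ,
          Integrable (fun ω => ‖what t ω - wstar‖ ^ 2) ρ ∧
          Integrable (fun ω => ‖w t ω - wstar‖ ^ 2) ρ) ∧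
        (∀ t : ℕ, 2 ≤ t →
          ∫ ω, ‖what t ω - wstar‖ ^ 2 ∂ρ ≤
            4 * α ^ 2 * D * N / μ ^ 2 * (t / (t + E - 1) ^ 2) +
              C * (Real.log t / (t + E - 1) ^ 2) ∧
          ∫ ω, ‖w t ω - wstar‖ ^ 2 ∂ρ ≤
            4 * α ^ 2 * D * N / μ ^ 2 * (t / (t + E - 1) ^ 2) +
              C * (Real.log t / (t + E - 1) ^ 2)) := by
  -- The constant is chosen before the data, so `N` is still an arbitrary real; a negative value is
  -- incompatible with the later hypotheses.
  by_cases hN0 : 0 ≤ N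
  swap
  · refine ⟨0, ?_⟩
    intro d Ξ Ω _ _ P _ ρ _ f wstar w₀ S a ξ u mask w what _ _ _ _ _ _ hN
    exact absurd (hN ▸ mul_nonneg two_pos.le (integral_nonneg fun x => by positivity)) hN0
  have hα0 : 0 < α := by linarith
  have hD0 : (0 : ℝ) < D := by exact_mod_cast hD
  have hE0 : 0 < E := lt_of_lt_of_le (by positivity) hE
  obtain ⟨C, hC⟩ := Hogwild.IsDelayedRecursion.exists_rate (E := E)
    (K := (4 * L ^ 2 / μ + 5 / 4 * μ) * (α / μ)) (A := (α / μ) ^ 2 * (D * N))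
    (a := τ * (α / μ) ^ 2 * (D * (2 * L ^ 2))) (b := τ * (α / μ) ^ 2 * (D * N)) (R := R) (τ := τ)
    hE0 (by positivity) (by positivity) (by positivity) (by positivity)
  refine ⟨C, ?_⟩
  intro d Ξ Ω _ _ P _ ρ _ f wstar w₀ S a ξ u mask w what hf hint hF hs hmin hsq hN hR hS ha hrun
  refine ⟨fun t => ?_, fun t => ?_, ?_⟩
  · obtain ⟨h1, h2⟩ := hrun.integral_numUpdates hD hS t
    rw [Hogwild.deltaBar_div hD, h2]
    refine ⟨h1, mul_le_mul_of_nonneg_left (Hogwild.integral_card_div_le hD hS) t.cast_nonneg,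
      fun hae => ?_⟩
    congr 1
    exact integral_congr_ae (hae.mono fun x hx => Hogwild.card_div_eq_ceil hD (f x) hx)
  · obtain ⟨h1, h2⟩ := hrun.memLp_iterate hD hS hf hs hsq t
    exact ⟨(h2.sub (memLp_const wstar)).integrable_norm_pow two_ne_zero,
      (h1.sub (memLp_const wstar)).integrable_norm_pow two_ne_zero⟩
  have hp : ∀ t : ℕ, 0 < (t : ℝ) + E := fun t => by positivity
  have hη0 : ∀ t : ℕ, 0 ≤ a t / (μ * (t + E)) := fun t =>
    div_nonneg (by linarith [(ha t).1]) (mul_pos hμ (hp t)).le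
  have hηle : ∀ t : ℕ, a t / (μ * (t + E)) ≤ α / μ * (1 / (t + E)) := fun t => by
    rw [div_mul_div_comm, mul_one]
    exact div_le_div_of_nonneg_right (ha t).2 (mul_pos hμ (hp t)).le
  have hηge : ∀ t : ℕ, 2 * (1 / ((t : ℝ) + E)) ≤ μ * (a t / (μ * (t + E))) / 2 := fun t => by
    have h1 : μ * (a t / (μ * (t + E))) / 2 = a t / 2 * (1 / (t + E)) := by
      have := (hp t).ne'
      field_simp
    rw [h1]
    exact mul_le_mul_of_nonneg_right (by linarith [(ha t).1]) (by positivity)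
  -- The only use of the full lower bound on `E`, which says `4 α L² D ≤ μ² E`; elsewhere `E > 0` is
  -- enough.
  have hηL : ∀ t : ℕ, a t / (μ * (t + E)) * (4 * L ^ 2 * D) ≤ μ := fun t => by
    rw [div_mul_eq_mul_div, div_le_iff₀ (mul_pos hμ (hp t))]
    have h1 : 4 * L * (L / μ) * α * D / μ = α * (4 * L ^ 2 * D) / (μ * μ) := by
      field_simp
    rw [h1, div_le_iff₀ (by positivity)] at hE
    have h2 : a t * (4 * L ^ 2 * D) ≤ α * (4 * L ^ 2 * D) :=
      mul_le_mul_of_nonneg_right (ha t).2 (by positivity)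
    have h3 : 0 ≤ μ * μ * t := by positivity
    linarith
  have hrec : Hogwild.IsDelayedRecursion E ((4 * L ^ 2 / μ + 5 / 4 * μ) * (α / μ))
      ((α / μ) ^ 2 * (D * N)) (τ * (α / μ) ^ 2 * (D * (2 * L ^ 2))) (τ * (α / μ) ^ 2 * (D * N)) τ
      (fun t => ∫ ω, ‖w t ω - wstar‖ ^ 2 ∂ρ) (fun t => ∫ ω, ‖what t ω - wstar‖ ^ 2 ∂ρ)
      (fun t => ∫ ω, ‖what t ω - w t ω‖ ^ 2 ∂ρ) := by
    refine Hogwild.isDelayedRecursion_of_stepSize hD0.le (by positivity) hN0 (by positivity)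
      hη0 hηle hηge (fun t => integral_nonneg fun ω => by positivity)
      (fun t => integral_nonneg fun ω => by positivity)
      (fun t => integral_nonneg fun ω => by positivity) (fun t => ?_) (fun t => ?_)
      (fun t => hrun.integral_norm_read_sq_le hD hS hf hs hsq t)
    · rw [hN]
      exact hrun.integral_norm_succ_sq_le hD hL.le hμ hS hf hint hF hmin hs hsq t (hη0 t) (hηL t)
    · rw [hN]
      exact hrun.integral_norm_read_sub_sq_le hD hS hf hs hsq t
  have h0 : ∫ ω, ‖w 0 ω - wstar‖ ^ 2 ∂ρ = R ^ 2 := by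
    simp [hrun.start, hR]
  have hA : 4 * α ^ 2 * D * N / μ ^ 2 = 4 * ((α / μ) ^ 2 * (D * N)) := by
    field_simp
  rw [hA]
  exact hC _ _ _ hrec h0
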